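/- Let $R$ be an irreducible reduced (crystallographic) root system in an $\ell$-dimensional Euclidean space $(V,(\cdot,\cdot))$ with Weyl group $W$, simple roots $\alpha_1,\dots,\alpha_\ell$, coroots $\alpha_j^\vee=2\alpha_j/(\alpha_j,\alpha_j)$ and fundamental weights $\omega_1,\dots,\omega_\ell$, $(\omega_i,\alpha_j^\vee)=\delta_{ij}$. Fix a nonzero weight $\omega=\sum_j m_j\omega_j$ with $m_j\in\mathbb Z_{\ge 0}$. Put $\theta_j=(\omega_j,\omega)$ and $\kappa=\gcd\{(\omega,\alpha_r)\mid r=1,\dots,\ell\}$, i.e. the largest real number of which all $(\omega,\alpha_r)$ are integral multiples. Consider complex-valued functions of real variables $(x^1,\dots,x^\ell;c)$, write $\mathbf x=c\,\omega+x^1\alpha_1^\vee+\dots+x^\ell\alpha_\ell^\vee$, let $\lambda=e^{-2\pi i\kappa c}$, and let $$\mathscr A=\mathbb C[\lambda]\otimes\mathbb C[e^{\pm 2\pi i x^1},\dots,e^{\pm 2\pi i x^\ell}],$$ regarded as a ring of such functions and graded by $\deg e^{2\pi i x^j}=\theta_j$, $\deg e^{2\pi i c}=-1$ (so $\deg\lambda=\kappa$).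 The affine Weyl group $W_a(R)$, consisting of the maps $\mathbf x\mapsto\sigma(\mathbf x)+\sum_j k_j\alpha_j^\vee$ ($\sigma\in W$, $k_j\in\mathbb Z$), acts on the coordinates $x$ with $c$ kept fixed; $\mathscr A^W$ denotes the subring of invariant elements of $\mathscr A$. Since an element $f$ of $\mathscr A$ is in a unique way a polynomial in $\lambda$ with coefficients in $\mathbb C[e^{\pm 2\pi i x^j}]$, the function $f|_{\lambda=\mu}$ of $x\in\mathbb C^\ell$ is defined for every $\mu\in\mathbb C$. Let $$y^j=e^{-2\pi i\theta_j c}\,\frac1{N_j}\sum_{\sigma\in W}e^{2\pi i(\omega_j,\sigma(\mathbf x))}\in\mathscr A^W,\qquad N_j=\#\{\sigma\in W\mid\sigma(\omega_j)=\omega_j\}.$$ A set of proper generators of $\mathscr A^W$ is a family $z^1,\dots,z^\ell\in\mathscr A^W$ such that $z^j$ is homogeneous of degree $\theta_j$ and $z^j|_{\lambda=0}=y^j|_{\lambda=0}$ for $j=1,\dots,\ell$. Then for every set $\{z^1,\dots,z^\ell\}$ of proper generators of $\mathscr A^W$: 1. $\mathscr A^W=\mathbb C[z^1,\dots,z^\ell,\lambda]$,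 i.e. $\mathscr A^W$ is generated as a $\mathbb C$-algebra by $z^1,\dots,z^\ell$ and $\lambda$. 2. For every $\mu\in\mathbb C$ and $x\in\mathbb C^\ell$, $$\det\Bigl(\frac{\partial (z^j|_{\lambda=\mu})}{\partial x^p}\Bigr)(x)=\det\Bigl(\frac{\partial (y^j|_{\lambda=\mu})}{\partial x^p}\Bigr)(x).$$ 3. For every $\mu\in\mathbb C$ the functions $z^1|_{\lambda=\mu},\dots,z^\ell|_{\lambda=\mu}$ on $\mathbb C^\ell$ are functionally independent: if $U\subset\mathbb C^\ell$ is open and $F$ is a function that is analytic at every point $z(x)=(z^1|_{\lambda=\mu}(x),\dots,z^\ell|_{\lambda=\mu}(x))$ with $x\in U$ and satisfies $F(z(x))=0$ for all $x\in U$, then $F$ vanishes in a neighbourhood of $z(x)$ for each $x\in U$. -/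

import Mathlib

open scoped InnerProductSpace Topology

noncomputable section

namespace AffineWeyl

/-! ### Root-system data in a Euclidean space -/

section RootData

variable {ι V N : Type*} [NormedAddCommGroup V] [InnerProductSpace ℝ V]
  [AddCommGroup N] [Module ℝ N] {P : RootPairing ι ℝ V N}

/-- The reflections of the root system are orthogonal for the inner product of `V`, so that the
roots form a root system in the Euclidean space `V`. -/
def IsEuclidean (P : RootPairing ι ℝ V N) : Prop :=
  ∀ (i : ι) (v w : V), ⟪P.reflection i v, P.reflection i w⟫_ℝ = ⟪v, w⟫_ℝ

/-- The coroot `α^∨ = 2 α / (α, α)`, as a vector of the Euclidean space `V`. -/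
def coroot (P : RootPairing ι ℝ V N) (i : ι) : V :=
  (2 / ⟪P.root i, P.root i⟫_ℝ) • P.root i

lemma two_div_inner_root_ne_zero (P : RootPairing ι ℝ V N) (i : ι) :
    2 / ⟪P.root i, P.root i⟫_ℝ ≠ 0 :=
  div_ne_zero two_ne_zero (inner_self_ne_zero.mpr (P.ne_zero i))

variable [P.IsRootSystem] (b : P.Base)

/-- The basis of `V` formed by the simple coroots. -/
def corootBasis : Module.Basis b.support ℝ V :=
  b.toWeightBasis.isUnitSMul
    (w := fun i : b.support => 2 / ⟪P.root (i : ι), P.root (i : ι)⟫_ℝ)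
    fun i => (two_div_inner_root_ne_zero P i).isUnit

lemma corootBasis_apply (i : b.support) : corootBasis b i = coroot P i := by
  simp [corootBasis, coroot, Module.Basis.isUnitSMul_apply]

variable [FiniteDimensional ℝ V]

/-- The fundamental weights: the basis of `V` dual to the simple coroots, see
`inner_fundWeight_coroot`. -/
def fundWeight (j : b.support) : V :=
  haveI : CompleteSpace V := FiniteDimensional.complete ℝ V
  (InnerProductSpace.toDual ℝ V).symm (LinearMap.toContinuousLinearMap ((corootBasis b).coord j))

lemma inner_fundWeight_coroot (i j : b.support) [Decidable (i = j)] :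
    ⟪fundWeight b i, coroot P j⟫_ℝ = if i = j then 1 else 0 := by
  classical
  rw [← corootBasis_apply, fundWeight]
  simp [Finsupp.single_apply, @eq_comm _ j i]

/-- The weight `ω = ∑ m_j ω_j`. -/
def weight (m : b.support → ℕ) : V :=
  ∑ j, (m j : ℝ) • fundWeight b j

/-- The numbers `θ_j = (ω_j, ω)`. -/
def theta (m : b.support → ℕ) (j : b.support) : ℝ :=
  ⟪fundWeight b j, weight b m⟫_ℝ

/-- The greatest common divisor `κ` of the numbers `(ω, α_r)`: the largest real number of which
all the `(ω, α_r)` are integral multiples. -/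
def kappa (m : b.support → ℕ) : ℝ :=
  sSup {t : ℝ | ∀ r : b.support, ∃ n : ℤ, ⟪weight b m, P.root r⟫_ℝ = n * t}

/-- The point `𝐱 = c ω + ∑ x^j α_j^∨` of `V` with affine coordinates `p = (x; c)`. -/
def point (m : b.support → ℕ) (p : (b.support → ℝ) × ℝ) : V :=
  p.2 • weight b m + ∑ j, p.1 j • coroot P j

/-- A function of the affine coordinates `(x; c)` is invariant under the affine Weyl group, which
consists of the maps `𝐱 ↦ σ(𝐱) + ∑ k_j α_j^∨` with `σ` in the Weyl group and `k_j ∈ ℤ`, and which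
acts on the coordinates `x` while `c` is kept. -/
def IsInvariant (m : b.support → ℕ) (f : (b.support → ℝ) × ℝ → ℂ) : Prop :=
  ∀ (σ : P.weylGroup) (k : b.support → ℤ) (x x' : b.support → ℝ) (c : ℝ),
    point b m (x', c) = σ • point b m (x, c) + ∑ j, (k j : ℝ) • coroot P j →
      f (x', c) = f (x, c)

/-- `Y_j = N_j⁻¹ ∑_{σ ∈ W} exp (2 π i (ω_j, σ(𝐱)))`, with `N_j` the order of the stabilizer
of `ω_j`. -/
def bigY (m : b.support → ℕ) (j : b.support) (p : (b.support → ℝ) × ℝ) : ℂ :=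
  (Nat.card {σ : P.weylGroup // σ • fundWeight b j = fundWeight b j} : ℂ)⁻¹ *
    ∑ᶠ σ : P.weylGroup,
      Complex.exp (2 * Real.pi * Complex.I * (⟪fundWeight b j, σ • point b m p⟫_ℝ : ℝ))

/-- The basic generators `y^j = exp (-2 π i θ_j c) Y_j`. -/
def basicGen (m : b.support → ℕ) (j : b.support) (p : (b.support → ℝ) × ℝ) : ℂ :=
  Complex.exp (-(2 * Real.pi * Complex.I * (theta b m j * p.2 : ℝ))) * bigY b m j p

end RootData

lemma finite_weylGroup {ι V N : Type*} [Finite ι] [AddCommGroup V] [Module ℝ V]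
    [AddCommGroup N] [Module ℝ N] (P : RootPairing ι ℝ V N) [P.IsRootSystem] :
    Finite P.weylGroup := by
  refine Finite.of_injective (fun g : P.weylGroup => P.weylGroupToPerm g) fun g h hgh => ?_
  apply Subtype.ext
  apply RootPairing.Equiv.weightHom_injective P
  apply LinearEquiv.toLinearMap_injective
  refine LinearMap.ext_on_range (v := P.root) RootPairing.IsRootSystem.span_root_eq_top fun i => ?_
  have hg := P.weylGroup_apply_root g i
  have hh := P.weylGroup_apply_root h i
  have hgh' : P.weylGroupToPerm g = P.weylGroupToPerm h := hgh
  rw [hgh'] at hg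
  exact hg.trans hh.symm

/-! ### Fourier polynomials -/

section Fourier

variable {s : Type*} [Fintype s]

/-- The function `exp (2 π i (t₀ c + ∑ t_j x^j))` of `(x; c)`. -/
def mono (t₀ : ℝ) (t : s → ℝ) : (s → ℝ) × ℝ → ℂ := fun p =>
  Complex.exp (2 * Real.pi * Complex.I * (t₀ * p.2 + ∑ j, t j * p.1 j : ℝ))

/-- `f` is a homogeneous Fourier function of degree `d`, where `deg exp (2 π i x^j) = θ_j` and
`deg exp (2 π i c) = -1`. -/
def IsHomogeneous (θ : s → ℝ) (d : ℝ) (f : (s → ℝ) × ℝ → ℂ) : Prop :=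
  f ∈ Submodule.span ℂ {g | ∃ (t₀ : ℝ) (t : s → ℝ), -t₀ + ∑ j, t j * θ j = d ∧ g = mono t₀ t}

/-- `λ = exp (-2 π i κ c)`. -/
def lam (κ : ℝ) : (s → ℝ) × ℝ → ℂ := mono (-κ) 0

open Classical in
/-- The `λ`-Fourier polynomial ring `𝒜`, generated by `λ` and the `exp (± 2 π i x^j)`. -/
def lamFourier (κ : ℝ) : Subalgebra ℂ ((s → ℝ) × ℝ → ℂ) :=
  Algebra.adjoin ℂ ({lam κ} ∪ Set.range (fun j : s => mono 0 (Pi.single j 1)) ∪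
    Set.range (fun j : s => mono 0 (Pi.single j (-1))))

/-- A formal Laurent polynomial (a combination of `λ ^ a₀ exp (2 π i ∑ a_j x^j)` with `a₀ ∈ ℕ`,
`a_j ∈ ℤ`) as a function of `λ ∈ ℂ` and `x ∈ ℂ ^ ℓ`. -/
def laurentEval : AddMonoidAlgebra ℂ (ℕ × (s → ℤ)) →ₐ[ℂ] (ℂ × (s → ℂ) → ℂ) :=
  AddMonoidAlgebra.lift ℂ _ (ℕ × (s → ℤ))
    { toFun := fun a q => q.1 ^ a.toAdd.1 *
        Complex.exp (2 * Real.pi * Complex.I * ∑ j, (a.toAdd.2 j : ℂ) * q.2 j)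
      map_one' := by
        funext q
        simp
      map_mul' := by
        intro a a'
        funext q
        simp only [toAdd_mul, Prod.fst_add, Prod.snd_add, Pi.add_apply, Pi.mul_apply, pow_add,
          Int.cast_add, add_mul, Finset.sum_add_distrib, mul_add, Complex.exp_add]
        ring }

/-- The formal Laurent polynomial `Q` represents the function `f` of `(x; c)`: substituting
`λ = exp (-2 π i κ c)` in `Q` gives `f`. -/
def Represents (κ : ℝ) (Q : AddMonoidAlgebra ℂ (ℕ × (s → ℤ))) (f : (s → ℝ) × ℝ → ℂ) : Prop :=
  ∀ p : (s → ℝ) × ℝ, f p = laurentEval Q (lam κ p, fun j => (p.1 j : ℂ))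

open Classical in
/-- The function `f|_{λ = μ}` of `x ∈ ℂ ^ ℓ`, for `f` in the `λ`-Fourier polynomial ring and
`μ ∈ ℂ`: write `f` as a polynomial in `λ` and the `exp (± 2 π i x^j)` and put `λ = μ`.
By `exists_represents` and `specialize_eq` this is meaningful and well defined when `κ ≠ 0`. -/
def specialize (κ : ℝ) (f : (s → ℝ) × ℝ → ℂ) (μ : ℂ) (x : s → ℂ) : ℂ :=
  if h : ∃ Q, Represents κ Q f then laurentEval h.choose (μ, x) else 0

open Classical in
lemma exists_represents {κ : ℝ} {f : (s → ℝ) × ℝ → ℂ} (hf : f ∈ lamFourier κ) :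
    ∃ Q, Represents κ Q f := by
  let ρ : (ℂ × (s → ℂ) → ℂ) →ₐ[ℂ] ((s → ℝ) × ℝ → ℂ) :=
    { toFun := fun g p => g (lam κ p, fun j => (p.1 j : ℂ))
      map_one' := rfl
      map_mul' := fun _ _ => rfl
      map_zero' := rfl
      map_add' := fun _ _ => rfl
      commutes' := fun _ => rfl }
  have key : lamFourier κ ≤ (ρ.comp (laurentEval (s := s))).range := by
    refine Algebra.adjoin_le ?_
    rintro g ((hg | ⟨j, rfl⟩) | ⟨j, rfl⟩)
    · obtain rfl : g = lam κ := hg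
      refine ⟨AddMonoidAlgebra.single (1, 0) 1, ?_⟩
      funext p
      change laurentEval _ (lam κ p, fun j => (p.1 j : ℂ)) = _
      simp [laurentEval]
    · refine ⟨AddMonoidAlgebra.single (0, Pi.single j 1) 1, ?_⟩
      funext p
      change laurentEval _ (lam κ p, fun j => (p.1 j : ℂ)) = _
      simp [laurentEval, mono, Pi.single_apply]
    · refine ⟨AddMonoidAlgebra.single (0, Pi.single j (-1)) 1, ?_⟩
      funext p
      change laurentEval _ (lam κ p, fun j => (p.1 j : ℂ)) = _
      simp [laurentEval, mono, Pi.single_apply]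
  obtain ⟨Q, hQ⟩ := key hf
  exact ⟨Q, fun p => (congrFun hQ p).symm⟩

lemma exists_exp_ne {a a' : ℝ} (h : a ≠ a') :
    ∃ t : ℝ, Complex.exp (2 * Real.pi * Complex.I * (a * t : ℝ)) ≠
      Complex.exp (2 * Real.pi * Complex.I * (a' * t : ℝ)) := by
  refine ⟨1 / (2 * (a - a')), fun he => ?_⟩
  have h0 : (a : ℂ) - a' ≠ 0 := by
    rw [← Complex.ofReal_sub]
    exact_mod_cast sub_ne_zero.mpr h
  have h1 : 2 * Real.pi * Complex.I * ((a * (1 / (2 * (a - a'))) : ℝ) : ℂ) =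
      2 * Real.pi * Complex.I * ((a' * (1 / (2 * (a - a'))) : ℝ) : ℂ) + Real.pi * Complex.I := by
    push_cast
    field_simp
    ring
  rw [h1, Complex.exp_add, Complex.exp_pi_mul_I] at he
  have := Complex.exp_ne_zero
    (2 * Real.pi * Complex.I * ((a' * (1 / (2 * (a - a'))) : ℝ) : ℂ))
  apply this
  linear_combination (-1 / 2 : ℂ) * he

/-- The character `exp (2 π i (-a₀ κ c + ∑ a_j x^j))` of the group of all `(x; c)`. -/
def character (κ : ℝ) (a : ℕ × (s → ℤ)) : Multiplicative ((s → ℝ) × ℝ) →* ℂ where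
  toFun p := mono (-(κ * a.1)) (fun j => (a.2 j : ℝ)) p.toAdd
  map_one' := by simp [mono]
  map_mul' p p' := by
    simp only [mono, toAdd_mul, Prod.fst_add, Prod.snd_add, Pi.add_apply, ← Complex.exp_add,
      mul_add, Finset.sum_add_distrib]
    congr 1
    push_cast
    ring

open Classical in
lemma character_injective {κ : ℝ} (hκ : κ ≠ 0) : Function.Injective (character (s := s) κ) := by
  rintro ⟨a, k⟩ ⟨a', k'⟩ h
  have h' : ∀ p : (s → ℝ) × ℝ, mono (-(κ * a)) (fun j => (k j : ℝ)) p =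
      mono (-(κ * a')) (fun j => (k' j : ℝ)) p := fun p => DFunLike.congr_fun h (.ofAdd p)
  refine Prod.ext ?_ (funext fun j => ?_)
  · by_contra hne
    have hne' : (-(κ * a) : ℝ) ≠ -(κ * a') := by
      intro he
      have := mul_left_cancel₀ hκ (neg_injective he)
      exact hne (by exact_mod_cast this)
    obtain ⟨t, ht⟩ := exists_exp_ne hne'
    apply ht
    simpa [mono] using h' (0, t)
  · by_contra hne
    have hne' : (k j : ℝ) ≠ k' j := by exact_mod_cast hne
    obtain ⟨t, ht⟩ := exists_exp_ne hne'
    apply ht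
    simpa [mono, Pi.single_apply] using h' (Pi.single j t, 0)

lemma laurentEval_eq (κ : ℝ) (Q : AddMonoidAlgebra ℂ (ℕ × (s → ℤ))) (p : (s → ℝ) × ℝ) :
    laurentEval Q (lam κ p, fun j => (p.1 j : ℂ)) =
      Finsupp.linearCombination ℂ (fun a => (character κ a : _ → ℂ)) Q.coeff (.ofAdd p) := by
  rw [laurentEval, AddMonoidAlgebra.lift_apply, Finsupp.linearCombination_apply, Finsupp.sum,
    Finsupp.sum, Finset.sum_apply, Finset.sum_apply]
  refine Finset.sum_congr rfl fun a _ => ?_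
  simp only [Pi.smul_apply, smul_eq_mul, MonoidHom.coe_mk, OneHom.coe_mk, toAdd_ofAdd, character,
    mono, lam, ← Complex.exp_nat_mul, ← Complex.exp_add]
  congr 2
  simp
  ring

lemma represents_unique {κ : ℝ} (hκ : κ ≠ 0) {f : (s → ℝ) × ℝ → ℂ}
    {Q Q' : AddMonoidAlgebra ℂ (ℕ × (s → ℤ))} (h : Represents κ Q f) (h' : Represents κ Q' f) :
    Q = Q' := by
  have hli : LinearIndependent ℂ
      (fun a : ℕ × (s → ℤ) => (character κ a : Multiplicative ((s → ℝ) × ℝ) → ℂ)) :=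
    (linearIndependent_monoidHom (Multiplicative ((s → ℝ) × ℝ)) ℂ).comp _
      (character_injective hκ)
  have hc : Q.coeff = Q'.coeff := hli (by
    funext p
    have := (h p.toAdd).symm.trans (h' p.toAdd)
    rwa [laurentEval_eq, laurentEval_eq] at this)
  cases Q
  cases Q'
  exact congrArg _ hc

lemma specialize_eq {κ : ℝ} (hκ : κ ≠ 0) {f : (s → ℝ) × ℝ → ℂ}
    {Q : AddMonoidAlgebra ℂ (ℕ × (s → ℤ))} (h : Represents κ Q f) (μ : ℂ) (x : s → ℂ) :
    specialize κ f μ x = laurentEval Q (μ, x) := by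
  have h0 : ∃ Q, Represents κ Q f := ⟨Q, h⟩
  rw [specialize, dif_pos h0, represents_unique hκ h0.choose_spec h]

open Classical in
/-- The Jacobian determinant `det (∂ f_j / ∂ x^p)` of `ℓ` functions on `ℂ ^ ℓ`. -/
def jacobian (f : s → (s → ℂ) → ℂ) (x : s → ℂ) : ℂ :=
  Matrix.det (Matrix.of fun j p : s => fderiv ℂ (f j) x (Pi.single p 1))

/-- The functions `f_j` are functionally independent: locally there is no nontrivial analytic
relation `F (f_1, …, f_ℓ) = 0`. -/
def FunctionallyIndependent (f : s → (s → ℂ) → ℂ) : Prop :=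
  ∀ (U : Set (s → ℂ)) (F : (s → ℂ) → ℂ), IsOpen U →
    (∀ x ∈ U, AnalyticAt ℂ F (fun j => f j x)) → (∀ x ∈ U, F (fun j => f j x) = 0) →
      ∀ x ∈ U, F =ᶠ[𝓝 (fun j => f j x)] 0

end Fourier

/-! ### The invariant ring and proper generators -/

section Main

variable {ι V N : Type*} [NormedAddCommGroup V] [InnerProductSpace ℝ V] [FiniteDimensional ℝ V]
  [AddCommGroup N] [Module ℝ N] {P : RootPairing ι ℝ V N} [P.IsRootSystem] (b : P.Base)

/-- The invariant `λ`-Fourier polynomial ring `𝒜^W`. -/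
def invariantRing (m : b.support → ℕ) : Subalgebra ℂ ((b.support → ℝ) × ℝ → ℂ) where
  carrier := {f | f ∈ lamFourier (kappa b m) ∧ IsInvariant b m f}
  mul_mem' := fun {f g} hf hg => ⟨mul_mem hf.1 hg.1, fun σ k x x' c h => by
    simp only [Pi.mul_apply, hf.2 σ k x x' c h, hg.2 σ k x x' c h]⟩
  add_mem' := fun {f g} hf hg => ⟨add_mem hf.1 hg.1, fun σ k x x' c h => by
    simp only [Pi.add_apply, hf.2 σ k x x' c h, hg.2 σ k x x' c h]⟩
  algebraMap_mem' := fun r => ⟨Subalgebra.algebraMap_mem _ r, fun _ _ _ _ _ _ => rfl⟩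

/-- `z` is a set of proper generators of `𝒜^W`: `z^j ∈ 𝒜^W` is homogeneous of degree `θ_j` and
`z^j|_{λ = 0} = y^j|_{λ = 0}`. -/
structure IsProperGenerators (m : b.support → ℕ) (z : b.support → (b.support → ℝ) × ℝ → ℂ) :
    Prop where
  mem : ∀ j, z j ∈ invariantRing b m
  homogeneous : ∀ j, IsHomogeneous (theta b m) (theta b m j) (z j)
  null_eq : ∀ j, specialize (kappa b m) (z j) 0 = specialize (kappa b m) (basicGen b m j) 0

end Main

end AffineWeyl

end

/-! Elements of `𝒜` are handled as Laurent polynomials in `λ` and the `exp (2 π i x^j)`; because `κ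
≠ 0`, independence of characters makes this representation unique. The monomial with exponent `(a,
k)` is recorded by its weight `β = ∑ k_j ω_j` and its degree `κ a + (β, ω)`. The Weyl group moves
`β` and fixes the degree.

Order weights by the height `(β, ρ)`. Since `ω_j - σ ω_j` is a nonnegative integral combination of
simple roots, `y^j` is `exp (2 π i x^j)` plus terms of the same degree, smaller height and
nonnegative `λ`-exponent (`exists_represents_basicGen`). In an invariant element, an exponent of
maximal height is dominant, since otherwise a simple reflection would raise it
(`exists_higher_exponent`). Hence subtracting multiples of `λ^a ∏ (y^j)^{k_j}` from the top down
exhausts every invariant (`mem_span_genMonomial_of_lower`), and `𝒜^W = ℂ[y, λ]`.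

This reduction preserves degree and divisibility by `λ`. So `z^j - y^j`, which is homogeneous of
degree `θ_j` and vanishes at `λ = 0`, is a polynomial in `λ` and those `y^i` with `θ_i < θ_j`. The
passage from `y` to `z` is therefore unipotent: it is inverted by recursion on `θ_j`, and at fixed
`λ` it multiplies the Jacobian matrix by a matrix of determinant 1.

For independence, the Jacobian matrix of `y`, with rows rescaled, tends to `2 π i` times the
identity along an imaginary ray (`exists_jacobian_ne_zero`). So the Jacobian is not identically
zero, and the open mapping property with the identity theorem excludes analytic relations
(`functionallyIndependent_of_jacobian`). -/

noncomputable section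

namespace AffineWeyl

/-! ### Triangular generators of a subalgebra of Laurent polynomials -/

section Triangular

variable {s : Type*} [Fintype s]

/-- The linear weight `∑ k_j r_j` of an exponent. -/
def linWeight (r : s → ℝ) (k : s → ℤ) : ℝ := ∑ j, (k j : ℝ) * r j

lemma linWeight_add (r : s → ℝ) (k k' : s → ℤ) :
    linWeight r (k + k') = linWeight r k + linWeight r k' := by
  simp [linWeight, add_mul, Finset.sum_add_distrib]

lemma linWeight_single [DecidableEq s] (r : s → ℝ) (j : s) : linWeight r (Pi.single j 1) = r j := by
  simp [linWeight, Pi.single_apply]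

/-- The degree `κ a + ∑ k_j θ_j` of the exponent `(a, k)`. -/
def expDegree (κ : ℝ) (θ : s → ℝ) (x : ℕ × (s → ℤ)) : ℝ := κ * x.1 + linWeight θ x.2

lemma expDegree_add (κ : ℝ) (θ : s → ℝ) (x y : ℕ × (s → ℤ)) :
    expDegree κ θ (x + y) = expDegree κ θ x + expDegree κ θ y := by
  simp only [expDegree, Prod.fst_add, Prod.snd_add, linWeight_add]
  push_cast
  ring

/-- The Laurent polynomials whose exponents lie in `S`. -/
def supportedIn (S : Set (ℕ × (s → ℤ))) : Submodule ℂ (AddMonoidAlgebra ℂ (ℕ × (s → ℤ))) where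
  carrier := {Q | ∀ x, Q.coeff x ≠ 0 → x ∈ S}
  add_mem' := fun {Q Q'} hQ hQ' x hx => by
    by_cases h : Q.coeff x = 0
    · refine hQ' x fun h' => hx ?_
      simp [h, h']
    · exact hQ x h
  zero_mem' := fun x hx => absurd (by simp) hx
  smul_mem' := fun c Q hQ x hx => hQ x fun h => hx (by simp [h])

omit [Fintype s] in
lemma supportedIn_mono {S S' : Set (ℕ × (s → ℤ))} (h : S ⊆ S') :
    supportedIn S ≤ supportedIn S' := fun _ hQ x hx => h (hQ x hx)

omit [Fintype s] in
lemma single_mem_supportedIn {S : Set (ℕ × (s → ℤ))} {x : ℕ × (s → ℤ)} (hx : x ∈ S) (c : ℂ) :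
    AddMonoidAlgebra.single x c ∈ supportedIn S := by
  classical
  intro y hy
  rw [AddMonoidAlgebra.coeff_single, Finsupp.single_apply] at hy
  by_cases h : x = y
  · exact h ▸ hx
  · simp [h] at hy

omit [Fintype s] in
lemma mul_mem_supportedIn {S S' S'' : Set (ℕ × (s → ℤ))}
    (h : ∀ x ∈ S, ∀ y ∈ S', x + y ∈ S'') {Q Q' : AddMonoidAlgebra ℂ (ℕ × (s → ℤ))}
    (hQ : Q ∈ supportedIn S) (hQ' : Q' ∈ supportedIn S') : Q * Q' ∈ supportedIn S'' := by
  classical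
  intro x hx
  have := AddMonoidAlgebra.support_coeff_mul_subset Q Q' (Finsupp.mem_support_iff.mpr hx)
  obtain ⟨y, hy, z, hz, rfl⟩ := Finset.mem_add.mp this
  exact h y (hQ y (Finsupp.mem_support_iff.mp hy)) z (hQ' z (Finsupp.mem_support_iff.mp hz))

/-- The exponents that may accompany the leading exponent `e`: they have the same degree,
smaller height and at least as large an exponent of `λ`. -/
def lowerExps (κ : ℝ) (θ h : s → ℝ) (e : ℕ × (s → ℤ)) : Set (ℕ × (s → ℤ)) :=
  {x | expDegree κ θ x = expDegree κ θ e ∧ linWeight h x.2 < linWeight h e.2 ∧ e.1 ≤ x.1}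

/-- `Q` is the monomial with exponent `e` plus terms with exponents in `lowerExps`. -/
def IsLeading (κ : ℝ) (θ h : s → ℝ) (Q : AddMonoidAlgebra ℂ (ℕ × (s → ℤ)))
    (e : ℕ × (s → ℤ)) : Prop :=
  Q - AddMonoidAlgebra.single e 1 ∈ supportedIn (lowerExps κ θ h e)

variable {κ : ℝ} {θ h : s → ℝ}

lemma isLeading_single (e : ℕ × (s → ℤ)) :
    IsLeading κ θ h (AddMonoidAlgebra.single e 1) e := by
  rw [IsLeading, sub_self]
  exact zero_mem _

/-- Degree, height and `λ`-exponent are all additive, so every product involving a lower term is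
itself lower than the product of the leading monomials. -/
lemma IsLeading.mul {Q Q' : AddMonoidAlgebra ℂ (ℕ × (s → ℤ))} {e e' : ℕ × (s → ℤ)}
    (hQ : IsLeading κ θ h Q e) (hQ' : IsLeading κ θ h Q' e') :
    IsLeading κ θ h (Q * Q') (e + e') := by
  have h1 : Q * Q' - AddMonoidAlgebra.single (e + e') 1 =
      (Q - AddMonoidAlgebra.single e 1) * (Q' - AddMonoidAlgebra.single e' 1) +
      (AddMonoidAlgebra.single e 1 * (Q' - AddMonoidAlgebra.single e' 1) +
      (Q - AddMonoidAlgebra.single e 1) * AddMonoidAlgebra.single e' 1) := by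
    rw [show AddMonoidAlgebra.single (e + e') (1 : ℂ) =
      AddMonoidAlgebra.single e 1 * AddMonoidAlgebra.single e' 1 by
        rw [AddMonoidAlgebra.single_mul_single, one_mul]]
    ring
  rw [IsLeading, h1]
  refine add_mem (mul_mem_supportedIn ?_ hQ hQ') (add_mem
    (mul_mem_supportedIn (S := {e}) ?_ (single_mem_supportedIn (Set.mem_singleton _) _) hQ')
    (mul_mem_supportedIn (S' := {e'}) ?_ hQ (single_mem_supportedIn (Set.mem_singleton _) _)))
  · rintro x ⟨hx1, hx2, hx3⟩ y ⟨hy1, hy2, hy3⟩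
    refine ⟨?_, ?_, add_le_add hx3 hy3⟩
    · simp only [expDegree_add, hx1, hy1]
    · simp only [Prod.snd_add, linWeight_add]
      exact add_lt_add hx2 hy2
  · rintro x rfl y ⟨hy1, hy2, hy3⟩
    refine ⟨?_, ?_, add_le_add le_rfl hy3⟩
    · simp only [expDegree_add, hy1]
    · simp only [Prod.snd_add, linWeight_add]
      exact add_lt_add_right hy2 _
  · rintro x ⟨hx1, hx2, hx3⟩ y rfl
    refine ⟨?_, ?_, add_le_add hx3 le_rfl⟩
    · simp only [expDegree_add, hx1]
    · simp only [Prod.snd_add, linWeight_add]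
      exact add_lt_add_left hx2 _

lemma IsLeading.pow {Q : AddMonoidAlgebra ℂ (ℕ × (s → ℤ))} {e : ℕ × (s → ℤ)}
    (hQ : IsLeading κ θ h Q e) (n : ℕ) : IsLeading κ θ h (Q ^ n) (n • e) := by
  induction n with
  | zero =>
    rw [pow_zero, zero_smul]
    exact isLeading_single 0
  | succ n ih =>
    rw [pow_succ, succ_nsmul]
    exact ih.mul hQ

lemma IsLeading.prod {t : Type*} (T : Finset t) {Q : t → AddMonoidAlgebra ℂ (ℕ × (s → ℤ))}
    {e : t → ℕ × (s → ℤ)} (hQ : ∀ i ∈ T, IsLeading κ θ h (Q i) (e i)) :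
    IsLeading κ θ h (∏ i ∈ T, Q i) (∑ i ∈ T, e i) := by
  classical
  induction T using Finset.induction_on with
  | empty => exact isLeading_single 0
  | insert i T hi ih =>
    rw [Finset.prod_insert hi, Finset.sum_insert hi]
    exact (hQ i (Finset.mem_insert_self i T)).mul
      (ih fun j hj => hQ j (Finset.mem_insert_of_mem hj))

/-- The exponent `(a, k)` with `k` nonnegative, as an exponent of a Laurent polynomial. -/
def natExp (x : ℕ × (s → ℕ)) : ℕ × (s → ℤ) := (x.1, fun j => (x.2 j : ℤ))

omit [Fintype s] in
lemma natExp_injective : Function.Injective (natExp (s := s)) := by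
  rintro ⟨a, k⟩ ⟨a', k'⟩ hx
  simp only [natExp, Prod.mk.injEq, funext_iff, Nat.cast_inj] at hx
  exact Prod.ext hx.1 (funext hx.2)

/-- The variable `λ` of the ring of Laurent polynomials. -/
def lamVar : AddMonoidAlgebra ℂ (ℕ × (s → ℤ)) := AddMonoidAlgebra.single (1, 0) 1

/-- The monomial `λ ^ a ∏ Y_j ^ k_j`. -/
def genMonomial (Y : s → AddMonoidAlgebra ℂ (ℕ × (s → ℤ))) (x : ℕ × (s → ℕ)) :
    AddMonoidAlgebra ℂ (ℕ × (s → ℤ)) :=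
  lamVar ^ x.1 * ∏ j, Y j ^ x.2 j

variable {Y : s → AddMonoidAlgebra ℂ (ℕ × (s → ℤ))}

lemma isLeading_genMonomial [DecidableEq s]
    (hY : ∀ j, IsLeading κ θ h (Y j) (0, Pi.single j 1))
    (x : ℕ × (s → ℕ)) : IsLeading κ θ h (genMonomial Y x) (natExp x) := by
  have h1 : natExp x = x.1 • ((1, 0) : ℕ × (s → ℤ)) +
      ∑ j, x.2 j • ((0, Pi.single j 1) : ℕ × (s → ℤ)) := by
    refine Prod.ext ?_ (funext fun j => ?_)
    · simp [natExp, Prod.fst_sum]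
    · simp [natExp, Prod.snd_sum, Finset.sum_apply, Pi.single_apply]
  rw [h1]
  exact ((isLeading_single _).pow _).mul (IsLeading.prod _ fun j _ => (hY j).pow _)

/-- The triangular reduction: an element of `I`, whose exponents of maximal height are dominant,
is a linear combination of the monomials in `λ` and the `Y_j`. -/
lemma mem_span_genMonomial_of_lower
    {I : Submodule ℂ (AddMonoidAlgebra ℂ (ℕ × (s → ℤ)))} {C : Set (ℕ × (s → ℤ))}
    (hI : ∀ Q ∈ I, ∀ x, Q.coeff x ≠ 0 → ∀ i, x.2 i < 0 →
      ∃ y, Q.coeff y ≠ 0 ∧ linWeight h x.2 < linWeight h y.2)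
    (hYI : ∀ x, genMonomial Y x ∈ I)
    (hY : ∀ x, IsLeading κ θ h (genMonomial Y x) (natExp x))
    (hC : ∀ x ∈ C, lowerExps κ θ h x ⊆ C)
    (T : Finset (ℕ × (s → ℕ)))
    (hT : ∀ x ∈ T, ∀ y, natExp y ∈ lowerExps κ θ h (natExp x) → y ∈ T)
    {Q : AddMonoidAlgebra ℂ (ℕ × (s → ℤ))} (hQ : Q ∈ I) (hQC : Q ∈ supportedIn C)
    (hQT : ∀ x, Q.coeff (natExp x) ≠ 0 → x ∈ T) :
    Q ∈ Submodule.span ℂ (genMonomial Y '' (natExp ⁻¹' C)) := by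
  classical
  induction hn : T.card generalizing T Q with
  | zero =>
    rw [Finset.card_eq_zero] at hn
    subst hn
    -- With no dominant exponent available, `Q` must vanish: by `hI` an exponent of maximal height
    -- has no negative coordinate, hence would lie in the empty `T`.
    suffices Q = 0 by
      rw [this]
      exact zero_mem _
    by_contra hne
    have hsupp : Q.coeff.support.Nonempty := by
      rw [Finsupp.support_nonempty_iff]
      intro h0
      exact hne (AddMonoidAlgebra.coeff_injective h0)
    obtain ⟨x, hx, hmax⟩ := Q.coeff.support.exists_max_image (fun x => linWeight h x.2) hsupp
    rw [Finsupp.mem_support_iff] at hx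
    by_cases hdom : ∀ i, 0 ≤ x.2 i
    · refine absurd (hQT (x.1, fun i => (x.2 i).toNat) ?_) (by simp)
      have : natExp (x.1, fun i => (x.2 i).toNat) = x := by
        refine Prod.ext rfl (funext fun i => ?_)
        simp [natExp, hdom i]
      rwa [this]
    · push Not at hdom
      obtain ⟨i, hi⟩ := hdom
      obtain ⟨y, hy, hlt⟩ := hI Q hQ x hx i hi
      exact absurd (hmax y (Finsupp.mem_support_iff.mpr hy)) (not_le.mpr hlt)
  | succ n ih =>
    have hne : T.Nonempty := Finset.card_pos.mp (by omega)
    obtain ⟨x, hx, hmax⟩ := T.exists_max_image (fun x => linWeight h (natExp x).2) hne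
    set c := Q.coeff (natExp x) with hc
    have hcoeff : ∀ y, y ∉ lowerExps κ θ h (natExp x) → y ≠ natExp x →
        (genMonomial Y x).coeff y = 0 := by
      intro y hy hyx
      by_contra hne
      refine hy (hY x y ?_)
      rw [AddMonoidAlgebra.coeff_sub, Finsupp.sub_apply, AddMonoidAlgebra.coeff_single,
          Finsupp.single_apply,
        if_neg (Ne.symm hyx), sub_zero]
      exact hne
    have hlead : (genMonomial Y x).coeff (natExp x) = 1 := by
      by_contra hne
      have : natExp x ∈ lowerExps κ θ h (natExp x) := by
        refine hY x _ ?_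
        rw [AddMonoidAlgebra.coeff_sub, Finsupp.sub_apply, AddMonoidAlgebra.coeff_single,
          Finsupp.single_apply,
          if_pos rfl]
        exact sub_ne_zero.mpr hne
      exact absurd this.2.1 (lt_irrefl _)
    have hsub : ∀ y, (Q - c • genMonomial Y x).coeff y =
        Q.coeff y - c * (genMonomial Y x).coeff y := fun y => by simp
    -- The chosen `x` need not occur in `Q`; only when it does is its monomial known to be
    -- admissible for `C`.
    have hcC : c ≠ 0 → natExp x ∈ C := fun h0 => hQC _ h0
    have hmon : c • genMonomial Y x ∈ Submodule.span ℂ (genMonomial Y '' (natExp ⁻¹' C)) := by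
      by_cases h0 : c = 0
      · rw [h0, zero_smul]
        exact zero_mem _
      · exact Submodule.smul_mem _ _ (Submodule.subset_span ⟨x, hcC h0, rfl⟩)
    have hmonC : c • genMonomial Y x ∈ supportedIn C := by
      by_cases h0 : c = 0
      · rw [h0, zero_smul]
        exact zero_mem _
      · refine Submodule.smul_mem _ _ fun y hy => ?_
        by_cases hyx : y = natExp x
        · exact hyx ▸ hcC h0
        · by_contra hyC
          exact hy (hcoeff y (fun hl => hyC (hC _ (hcC h0) hl)) hyx)
    -- As `x` has maximal height in `T`, it lies below no other element, so `T.erase x` is still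
    -- closed downwards. The subtraction cancels the coefficient at `x` and changes other dominant
    -- coefficients only inside `T`.
    have key := ih (T.erase x) ?_ (sub_mem hQ (I.smul_mem c (hYI x))) (sub_mem hQC hmonC) ?_ ?_
    · simpa using add_mem key hmon
    · intro y hy w hw
      refine Finset.mem_erase.mpr ⟨?_, hT y (Finset.mem_of_mem_erase hy) w hw⟩
      rintro rfl
      exact absurd (hmax y (Finset.mem_of_mem_erase hy)) (not_le.mpr hw.2.1)
    · intro y hy
      rw [hsub] at hy
      have hyx : y ≠ x := by
        rintro rfl
        rw [hlead, mul_one, ← hc, sub_self] at hy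
        exact hy rfl
      refine Finset.mem_erase.mpr ⟨hyx, ?_⟩
      by_contra hyT
      apply hy
      rw [hcoeff _ (fun hl => hyT (hT x hx y hl)) fun he => hyx (natExp_injective he), mul_zero,
        sub_zero]
      by_contra hne
      exact hyT (hQT y hne)
    · rw [Finset.card_erase_of_mem hx, hn]
      rfl

/-- The degree bounds the exponent of `λ` because `κ > 0`. It need not bound the `k_j`, as `θ_j` is
only assumed nonnegative; the positive heights do that. -/
lemma finite_natExp_le (hκ : 0 < κ) (hθ : ∀ j, 0 ≤ θ j) (hh : ∀ j, 0 < h j) (D H : ℝ) :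
    {x : ℕ × (s → ℕ) | expDegree κ θ (natExp x) ≤ D ∧ linWeight h (natExp x).2 ≤ H}.Finite := by
  classical
  refine (Set.finite_Iic (⟨⌈D / κ⌉₊, fun j => ⌈H / h j⌉₊⟩ : ℕ × (s → ℕ))).subset ?_
  rintro ⟨a, k⟩ ⟨h1, h2⟩
  simp only [expDegree, linWeight, natExp, Int.cast_natCast] at h1 h2
  have h3 : 0 ≤ ∑ j, (k j : ℝ) * θ j :=
    Finset.sum_nonneg fun j _ => mul_nonneg (Nat.cast_nonneg _) (hθ j)
  refine ⟨?_, fun j => ?_⟩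
  · have : (a : ℝ) ≤ D / κ := by
      rw [le_div_iff₀ hκ]
      linarith
    exact_mod_cast this.trans (Nat.le_ceil _)
  · have h4 : (k j : ℝ) * h j ≤ ∑ j, (k j : ℝ) * h j :=
      Finset.single_le_sum (f := fun j => (k j : ℝ) * h j)
        (fun i _ => mul_nonneg (Nat.cast_nonneg _) (hh i).le) (Finset.mem_univ j)
    have : (k j : ℝ) ≤ H / h j := by
      rw [le_div_iff₀ (hh j)]
      linarith
    exact_mod_cast this.trans (Nat.le_ceil _)

lemma mem_span_genMonomial (hκ : 0 < κ) (hθ : ∀ j, 0 ≤ θ j) (hh : ∀ j, 0 < h j)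
    {I : Submodule ℂ (AddMonoidAlgebra ℂ (ℕ × (s → ℤ)))} {C : Set (ℕ × (s → ℤ))}
    (hI : ∀ Q ∈ I, ∀ x, Q.coeff x ≠ 0 → ∀ i, x.2 i < 0 →
      ∃ y, Q.coeff y ≠ 0 ∧ linWeight h x.2 < linWeight h y.2)
    (hYI : ∀ x, genMonomial Y x ∈ I)
    (hY : ∀ x, IsLeading κ θ h (genMonomial Y x) (natExp x))
    (hC : ∀ x ∈ C, lowerExps κ θ h x ⊆ C)
    {Q : AddMonoidAlgebra ℂ (ℕ × (s → ℤ))} (hQ : Q ∈ I) (hQC : Q ∈ supportedIn C) :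
    Q ∈ Submodule.span ℂ (genMonomial Y '' (natExp ⁻¹' C)) := by
  obtain ⟨D, hD⟩ := (Q.coeff.support.image (expDegree κ θ)).bddAbove
  obtain ⟨H, hH⟩ := (Q.coeff.support.image fun x => linWeight h x.2).bddAbove
  have hfin := finite_natExp_le hκ hθ hh D H
  refine mem_span_genMonomial_of_lower hI hYI hY hC hfin.toFinset ?_ hQ hQC ?_
  · simp only [Set.Finite.mem_toFinset, Set.mem_ofPred_eq]
    rintro x ⟨h1, h2⟩ y ⟨h3, h4, -⟩
    exact ⟨h3.trans_le h1, h4.le.trans h2⟩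
  · intro x hx
    have hx' := Finsupp.mem_support_iff.mpr hx
    simp only [Set.Finite.mem_toFinset, Set.mem_ofPred_eq]
    exact ⟨hD (Finset.mem_coe.mpr (Finset.mem_image_of_mem _ hx')),
      hH (Finset.mem_coe.mpr (Finset.mem_image_of_mem _ hx'))⟩

lemma genMonomial_mem_adjoin (x : ℕ × (s → ℕ)) {G : Set (AddMonoidAlgebra ℂ (ℕ × (s → ℤ)))}
    (hG : ∀ j, x.2 j ≠ 0 → Y j ∈ G) :
    genMonomial Y x ∈ Algebra.adjoin ℂ (insert lamVar G) := by
  refine mul_mem (pow_mem (Algebra.subset_adjoin (Set.mem_insert _ _)) _)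
    (prod_mem fun j _ => ?_)
  by_cases hj : x.2 j = 0
  · rw [hj, pow_zero]
    exact one_mem _
  · exact pow_mem (Algebra.subset_adjoin (Set.mem_insert_of_mem _ (hG j hj))) _

/-- Invariant Laurent polynomials are polynomials in `λ` and triangular invariants `Y_j`, and a
homogeneous one of degree `d` which is divisible by `λ` involves only the `Y_j` with `θ_j < d`. -/
lemma mem_adjoin_of_isLeading [DecidableEq s] (hκ : 0 < κ) (hθ : ∀ j, 0 ≤ θ j) (hh : ∀ j, 0 < h j)
    {A : Subalgebra ℂ (AddMonoidAlgebra ℂ (ℕ × (s → ℤ)))}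
    (hA : ∀ Q ∈ A, ∀ x, Q.coeff x ≠ 0 → ∀ i, x.2 i < 0 →
      ∃ y, Q.coeff y ≠ 0 ∧ linWeight h x.2 < linWeight h y.2)
    (hlam : lamVar ∈ A) (hYA : ∀ j, Y j ∈ A)
    (hY : ∀ j, IsLeading κ θ h (Y j) (0, Pi.single j 1))
    {Q : AddMonoidAlgebra ℂ (ℕ × (s → ℤ))} (hQ : Q ∈ A) :
    Q ∈ Algebra.adjoin ℂ (insert lamVar (Set.range Y)) ∧
      ∀ d, Q ∈ supportedIn {x | 1 ≤ x.1 ∧ expDegree κ θ x = d} →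
        Q ∈ Algebra.adjoin ℂ (insert lamVar (Y '' {j | θ j < d})) := by
  have hYA' : ∀ x, genMonomial Y x ∈ A := fun x =>
    mul_mem (pow_mem hlam _) (prod_mem fun j _ => pow_mem (hYA j) _)
  refine ⟨?_, fun d hd => ?_⟩
  · have := mem_span_genMonomial (C := Set.univ) hκ hθ hh (I := Subalgebra.toSubmodule A) hA hYA'
      (isLeading_genMonomial hY) (fun _ _ => Set.subset_univ _) hQ fun _ _ => Set.mem_univ _
    refine (Submodule.span_le (p := Subalgebra.toSubmodule
      (Algebra.adjoin ℂ (insert lamVar (Set.range Y))))).mpr ?_ this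
    rintro _ ⟨x, -, rfl⟩
    exact genMonomial_mem_adjoin x fun j _ => ⟨j, rfl⟩
  -- This `C` is closed under lower exponents because these keep the degree and do not decrease the
  -- `λ`-exponent. A factor `Y j` in an admissible monomial then satisfies `θ j ≤ d - κ < d`.
  · have := mem_span_genMonomial (C := {x | 1 ≤ x.1 ∧ expDegree κ θ x = d}) hκ hθ hh
      (I := Subalgebra.toSubmodule A) hA hYA'
      (isLeading_genMonomial hY)
      (fun x hx y hy => ⟨hx.1.trans hy.2.2, hy.1.trans hx.2⟩) hQ hd
    refine (Submodule.span_le (p := Subalgebra.toSubmodule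
      (Algebra.adjoin ℂ (insert lamVar (Y '' {j | θ j < d}))))).mpr ?_ this
    rintro _ ⟨⟨a, k⟩, ⟨ha, hdeg⟩, rfl⟩
    refine genMonomial_mem_adjoin _ fun j hj => ⟨j, ?_, rfl⟩
    simp only [expDegree, linWeight, natExp, Int.cast_natCast] at ha hdeg
    have h1 : (k j : ℝ) * θ j ≤ ∑ j, (k j : ℝ) * θ j :=
      Finset.single_le_sum (f := fun j => (k j : ℝ) * θ j)
        (fun i _ => mul_nonneg (Nat.cast_nonneg _) (hθ i)) (Finset.mem_univ j)
    have h2 : (1 : ℝ) ≤ k j := by exact_mod_cast Nat.one_le_iff_ne_zero.mpr hj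
    have h3 : (1 : ℝ) ≤ a := by exact_mod_cast ha
    have h4 : κ ≤ κ * a := le_mul_of_one_le_right hκ.le h3
    have h5 : θ j ≤ k j * θ j := le_mul_of_one_le_left (hθ j) h2
    show θ j < d
    linarith

/-- If each `Z_j - Y_j` is a polynomial in `λ` and the `Y_i` with `θ_i < θ_j`, then every `Y_j` is
a polynomial in `λ` and the `Z_i`. -/
lemma mem_adjoin_of_sub_mem_adjoin {R : Type*} [CommRing R] [Algebra ℂ R] {t : Type*} [Finite t]
    {r : t → ℝ} {l : R} {Y Z : t → R}
    (hZ : ∀ j, Z j - Y j ∈ Algebra.adjoin ℂ (insert l (Y '' {i | r i < r j}))) (j : t) :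
    Y j ∈ Algebra.adjoin ℂ (insert l (Set.range Z)) := by
  -- On a finite index set the strict order of the real numbers `r j` is well founded, which permits
  -- recursion on the degree.
  have hwf : WellFounded fun i j : t => r i < r j := by
    have : IsTrans t fun i j => r i < r j := ⟨fun _ _ _ => lt_trans⟩
    have : Std.Irrefl fun i j : t => r i < r j := ⟨fun _ => lt_irrefl _⟩
    exact Finite.wellFounded_of_trans_of_irrefl _
  induction j using hwf.induction with
  | _ j ih =>
    have h1 : Z j - Y j ∈ Algebra.adjoin ℂ (insert l (Set.range Z)) := by
      refine Algebra.adjoin_le ?_ (hZ j)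
      rintro _ (rfl | ⟨i, hi, rfl⟩)
      · exact Algebra.subset_adjoin (Set.mem_insert _ _)
      · exact ih i hi
    have h2 : Z j ∈ Algebra.adjoin ℂ (insert l (Set.range Z)) :=
      Algebra.subset_adjoin (Set.mem_insert_of_mem _ ⟨j, rfl⟩)
    simpa using sub_mem h2 h1

end Triangular

/-! ### Jacobians of Laurent polynomials -/

section Jacobian

variable {s : Type*} [Fintype s]

lemma laurentEval_single (a : ℕ × (s → ℤ)) (c : ℂ) (q : ℂ × (s → ℂ)) :
    laurentEval (AddMonoidAlgebra.single a c) q =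
      c * (q.1 ^ a.1 * Complex.exp (2 * Real.pi * Complex.I * ∑ j, (a.2 j : ℂ) * q.2 j)) := by
  rw [laurentEval, AddMonoidAlgebra.lift_single]
  rfl

lemma laurentEval_lamVar (q : ℂ × (s → ℂ)) : laurentEval lamVar q = q.1 := by
  rw [lamVar, laurentEval_single]
  simp

lemma hasFDerivAt_expChar (k : s → ℤ) (x : s → ℂ) :
    HasFDerivAt (fun x : s → ℂ => Complex.exp (2 * Real.pi * Complex.I * ∑ j, (k j : ℂ) * x j))
      (Complex.exp (2 * Real.pi * Complex.I * ∑ j, (k j : ℂ) * x j) •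
        ((2 * Real.pi * Complex.I : ℂ) •
          ∑ j, (k j : ℂ) • ContinuousLinearMap.proj (R := ℂ) (φ := fun _ : s => ℂ) j)) x := by
  refine HasFDerivAt.cexp (HasFDerivAt.const_mul (HasFDerivAt.fun_sum fun j _ => ?_) _)
  exact (ContinuousLinearMap.proj (R := ℂ) (φ := fun _ : s => ℂ) j).hasFDerivAt.const_mul _

lemma analyticAt_laurentEval (Q : AddMonoidAlgebra ℂ (ℕ × (s → ℤ))) (μ : ℂ) (x : s → ℂ) :
    AnalyticAt ℂ (fun x => laurentEval Q (μ, x)) x := by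
  induction Q using AddMonoidAlgebra.induction_linear with
  | zero =>
    simp only [map_zero, Pi.zero_apply]
    exact analyticAt_const
  | add Q Q' hQ hQ' =>
    simp only [map_add, Pi.add_apply]
    exact hQ.add hQ'
  | single a c =>
    simp only [laurentEval_single]
    have h1 : AnalyticAt ℂ (fun x : s → ℂ => ∑ j, (a.2 j : ℂ) * x j) x := by
      refine Finset.analyticAt_fun_sum _ fun j _ => analyticAt_const.mul ?_
      exact (ContinuousLinearMap.proj (R := ℂ) (φ := fun _ : s => ℂ) j).analyticAt x
    exact analyticAt_const.mul (analyticAt_const.mul (analyticAt_const.mul h1).cexp)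

/-- The differential of `x ↦ Q(μ, x)`. -/
def laurentDeriv (μ : ℂ) (x : s → ℂ) (Q : AddMonoidAlgebra ℂ (ℕ × (s → ℤ))) :
    (s → ℂ) →L[ℂ] ℂ :=
  fderiv ℂ (fun x => laurentEval Q (μ, x)) x

lemma laurentDeriv_add (μ : ℂ) (x : s → ℂ) (Q Q' : AddMonoidAlgebra ℂ (ℕ × (s → ℤ))) :
    laurentDeriv μ x (Q + Q') = laurentDeriv μ x Q + laurentDeriv μ x Q' := by
  simp only [laurentDeriv, map_add, Pi.add_apply]
  exact fderiv_fun_add (analyticAt_laurentEval Q μ x).differentiableAt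
    (analyticAt_laurentEval Q' μ x).differentiableAt

lemma laurentDeriv_mul (μ : ℂ) (x : s → ℂ) (Q Q' : AddMonoidAlgebra ℂ (ℕ × (s → ℤ))) :
    laurentDeriv μ x (Q * Q') = laurentEval Q (μ, x) • laurentDeriv μ x Q' +
      laurentEval Q' (μ, x) • laurentDeriv μ x Q := by
  simp only [laurentDeriv, map_mul, Pi.mul_apply]
  exact fderiv_fun_mul (analyticAt_laurentEval Q μ x).differentiableAt
    (analyticAt_laurentEval Q' μ x).differentiableAt

lemma laurentDeriv_algebraMap (μ : ℂ) (x : s → ℂ) (c : ℂ) :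
    laurentDeriv μ x (algebraMap ℂ (AddMonoidAlgebra ℂ (ℕ × (s → ℤ))) c) = 0 := by
  simp only [laurentDeriv, AlgHom.commutes, Pi.algebraMap_apply]
  exact fderiv_const_apply _

/-- The Laurent polynomials whose differential lies in a given space form a subalgebra. -/
def derivSubalgebra (μ : ℂ) (x : s → ℂ) (W : Submodule ℂ ((s → ℂ) →L[ℂ] ℂ)) :
    Subalgebra ℂ (AddMonoidAlgebra ℂ (ℕ × (s → ℤ))) where
  carrier := {Q | laurentDeriv μ x Q ∈ W}
  mul_mem' := fun {Q Q'} hQ hQ' => by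
    rw [Set.mem_ofPred_eq] at hQ hQ' ⊢
    rw [laurentDeriv_mul]
    exact add_mem (W.smul_mem _ hQ') (W.smul_mem _ hQ)
  add_mem' := fun {Q Q'} hQ hQ' => by
    rw [Set.mem_ofPred_eq] at hQ hQ' ⊢
    rw [laurentDeriv_add]
    exact add_mem hQ hQ'
  algebraMap_mem' := fun c => by
    rw [Set.mem_ofPred_eq, laurentDeriv_algebraMap]
    exact zero_mem W

/-- Chain rule at the fixed value `λ = μ`: by the Leibniz rule the elements with differential in the
span form a subalgebra, and it contains `lamVar`, whose differential is zero. -/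
lemma laurentDeriv_mem_span (μ : ℂ) (x : s → ℂ) {Q : AddMonoidAlgebra ℂ (ℕ × (s → ℤ))}
    {G : Set (AddMonoidAlgebra ℂ (ℕ × (s → ℤ)))}
    (hQ : Q ∈ Algebra.adjoin ℂ (insert lamVar G)) :
    laurentDeriv μ x Q ∈ Submodule.span ℂ (laurentDeriv μ x '' G) := by
  refine Algebra.adjoin_le (S := derivSubalgebra μ x (Submodule.span ℂ (laurentDeriv μ x '' G)))
    ?_ hQ
  rintro _ (rfl | hg)
  · change laurentDeriv μ x lamVar ∈ Submodule.span ℂ (laurentDeriv μ x '' G)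
    simp only [laurentDeriv, laurentEval_lamVar]
    rw [fderiv_const_apply]
    exact zero_mem _
  · exact Submodule.subset_span ⟨_, hg, rfl⟩

open Classical in
/-- Changing each `g_j` by a function whose differential is a combination of the differentials
of the `g_i` with `r_i < r_j` does not change the Jacobian. -/
lemma jacobian_eq_of_sub_mem_span {f g : s → (s → ℂ) → ℂ} {x : s → ℂ} (r : s → ℝ)
    (hfg : ∀ j, fderiv ℂ (f j) x - fderiv ℂ (g j) x ∈
      Submodule.span ℂ ((fun i => fderiv ℂ (g i) x) '' {i | r i < r j})) :
    jacobian f x = jacobian g x := by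
  have h1 : ∀ j, ∃ c : s → ℂ, (∀ i, ¬ r i < r j → c i = 0) ∧
      fderiv ℂ (f j) x - fderiv ℂ (g j) x = ∑ i, c i • fderiv ℂ (g i) x := by
    intro j
    obtain ⟨c, hc, hsum⟩ := (Finsupp.mem_span_image_iff_linearCombination ℂ).mp (hfg j)
    refine ⟨c, fun i hi => ?_, ?_⟩
    · by_contra hne
      exact hi ((Finsupp.mem_supported ℂ c).mp hc (Finsupp.mem_support_iff.mpr hne))
    · rw [← hsum, Finsupp.linearCombination_apply, Finsupp.sum_fintype _ _ (by simp)]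
  choose c hc0 hc using h1
  have hmul : (Matrix.of fun j p : s => fderiv ℂ (f j) x (Pi.single p 1)) =
      (1 + Matrix.of c) * Matrix.of fun j p : s => fderiv ℂ (g j) x (Pi.single p 1) := by
    ext j p
    have := congrArg (fun L : (s → ℂ) →L[ℂ] ℂ => L (Pi.single p 1)) (hc j)
    simp only [sub_apply, sum_apply,
      smul_apply, smul_eq_mul] at this
    rw [add_mul, one_mul, Matrix.add_apply, Matrix.mul_apply]
    simp only [Matrix.of_apply]
    rw [← this]
    ring
  -- Blocks are indexed by the values of `r`, which may coincide for different indices; the strict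
  -- inequality makes each diagonal block an identity. The order is reversed because `c` is lower
  -- triangular for `r`.
  have htri : Matrix.BlockTriangular (1 + Matrix.of c) (fun j => OrderDual.toDual (r j)) := by
    intro i j hij
    have hij' : r i < r j := hij
    have hne : i ≠ j := fun h => (lt_irrefl _ (h ▸ hij'))
    rw [Matrix.add_apply, Matrix.one_apply_ne hne, zero_add, Matrix.of_apply]
    exact hc0 i j hij'.not_gt
  have hdet : (1 + Matrix.of c).det = 1 := by
    rw [htri.det]
    refine Finset.prod_eq_one fun a _ => ?_
    suffices (1 + Matrix.of c).toSquareBlock (fun j => OrderDual.toDual (r j)) a = 1 by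
      rw [this, Matrix.det_one]
    ext ⟨i, hi⟩ ⟨j, hj⟩
    have hij : r j = r i := OrderDual.toDual.injective (hj.trans hi.symm)
    rw [Matrix.toSquareBlock_def, Matrix.of_apply, Matrix.add_apply, Matrix.of_apply,
      hc0 i j (by rw [hij]; exact lt_irrefl _), add_zero, Matrix.one_apply, Matrix.one_apply]
    simp
  rw [jacobian, jacobian, hmul, Matrix.det_mul, hdet, one_mul]

/-! ### Functional independence from a Jacobian that is not identically zero -/

open Classical in
lemma analyticAt_jacobian {f : s → (s → ℂ) → ℂ} (hf : ∀ j x, AnalyticAt ℂ (f j) x) (x : s → ℂ) :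
    AnalyticAt ℂ (jacobian f) x := by
  have : jacobian f = fun x => ∑ σ : Equiv.Perm s, ((Equiv.Perm.sign σ : ℤ) : ℂ) *
      ∏ i, fderiv ℂ (f (σ i)) x (Pi.single i 1) := by
    funext x
    rw [jacobian, Matrix.det_apply']
    rfl
  rw [this]
  refine Finset.analyticAt_fun_sum _ fun σ _ => analyticAt_const.mul
    (Finset.analyticAt_fun_prod _ fun i _ => ?_)
  exact ((ContinuousLinearMap.apply ℂ ℂ (Pi.single i (1 : ℂ) : s → ℂ)).analyticAt _).comp
    (hf (σ i) x).fderiv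

open Classical in
lemma surjective_pi_fderiv_of_jacobian_ne_zero {f : s → (s → ℂ) → ℂ} {x : s → ℂ}
    (h : jacobian f x ≠ 0) :
    Function.Surjective (ContinuousLinearMap.pi fun j => fderiv ℂ (f j) x) := by
  intro w
  set M : Matrix s s ℂ := Matrix.of fun j p => fderiv ℂ (f j) x (Pi.single p 1) with hM
  have hunit : IsUnit M.det := isUnit_iff_ne_zero.mpr h
  have hmul : ∀ v, (ContinuousLinearMap.pi fun j => fderiv ℂ (f j) x) v = M.mulVec v := by
    intro v
    funext j
    rw [ContinuousLinearMap.pi_apply]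
    conv_lhs => rw [pi_eq_sum_univ' v, map_sum]
    refine Finset.sum_congr rfl fun p _ => ?_
    rw [map_smul, smul_eq_mul, mul_comm]
    rfl
  refine ⟨M⁻¹.mulVec w, ?_⟩
  rw [hmul, Matrix.mulVec_mulVec, Matrix.mul_nonsing_inv _ hunit, Matrix.one_mulVec]

/-- The Jacobian is analytic on a connected space, so its nonzero points are dense. Near such a
point `x'` close to `x` the map is open, so `F` vanishes near the image of `x'`. That image lies in
a ball around the image of `x` on which `F` is analytic, and the identity theorem spreads the
vanishing over the ball. -/
lemma functionallyIndependent_of_jacobian {f : s → (s → ℂ) → ℂ}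
    (hf : ∀ j x, AnalyticAt ℂ (f j) x) (hjac : ∃ x, jacobian f x ≠ 0) :
    FunctionallyIndependent f := by
  intro U F hU hF hF0 x hx
  obtain ⟨r, hr, hball⟩ := Metric.eventually_nhds_iff_ball.mp (hF x hx).eventually_analyticAt
  have hcont : Continuous fun x j => f j x :=
    continuous_pi fun j => continuous_iff_continuousAt.mpr fun x => (hf j x).continuousAt
  have hnear : ∀ᶠ x' in 𝓝 x, x' ∈ U ∧ (fun j => f j x') ∈ Metric.ball (fun j => f j x) r :=
    (hU.eventually_mem hx).and (hcont.continuousAt.eventually (Metric.ball_mem_nhds _ hr))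
  have hfreq : ∃ᶠ x' in 𝓝 x, jacobian f x' ≠ 0 := by
    intro hev
    simp only [not_not] at hev
    obtain ⟨x₀, hx₀⟩ := hjac
    refine hx₀ ?_
    exact AnalyticOnNhd.eqOn_zero_of_preconnected_of_eventuallyEq_zero (U := Set.univ)
      (fun x _ => analyticAt_jacobian hf x) isPreconnected_univ (Set.mem_univ x) hev
      (Set.mem_univ x₀)
  obtain ⟨x', hx', hx'U, hx'r⟩ := (hfreq.and_eventually hnear).exists
  have hstrict : HasStrictFDerivAt (fun x j => f j x)
      (ContinuousLinearMap.pi fun j => fderiv ℂ (f j) x') x' :=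
    hasStrictFDerivAt_pi'.mpr fun j => by
      simpa using! (hf j x').hasStrictFDerivAt
  have hF0' : F =ᶠ[𝓝 (fun j => f j x')] 0 := by
    rw [← hstrict.map_nhds_eq_of_surj
      (LinearMap.range_eq_top.mpr (surjective_pi_fderiv_of_jacobian_ne_zero hx'))]
    exact Filter.eventually_map.mpr ((hU.eventually_mem hx'U).mono hF0)
  have heq : Set.EqOn F 0 (Metric.ball (fun j => f j x) r) :=
    AnalyticOnNhd.eqOn_zero_of_preconnected_of_eventuallyEq_zero (fun y hy => hball y hy)
      (convex_ball _ _).isPreconnected hx'r hF0'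
  exact Filter.eventually_of_mem (Metric.ball_mem_nhds _ hr) heq

/-! ### Asymptotics of the Jacobian along an imaginary ray -/

/-- The point `-i t h` of `ℂ ^ s`, along which `exp (2 π i ∑ k_j x^j)` grows like
`exp (2 π t ∑ k_j h_j)`. -/
def imagRay (h : s → ℝ) (t : ℝ) : s → ℂ := fun j => -(Complex.I * (t * h j : ℝ))

lemma expChar_imagRay (h : s → ℝ) (t : ℝ) (k : s → ℤ) :
    Complex.exp (2 * Real.pi * Complex.I * ∑ j, (k j : ℂ) * imagRay h t j) =
      (Real.exp (2 * Real.pi * t * linWeight h k) : ℂ) := by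
  rw [Complex.ofReal_exp]
  congr 1
  simp only [imagRay, linWeight]
  push_cast
  rw [Finset.mul_sum, Finset.mul_sum]
  refine Finset.sum_congr rfl fun j _ => ?_
  linear_combination (-(2 * Real.pi * (k j : ℂ) * t * h j)) * Complex.I_mul_I

open Classical in
lemma laurentDeriv_single_imagRay (h : s → ℝ) (μ : ℂ) (t : ℝ) (a : ℕ × (s → ℤ)) (c : ℂ) (p : s) :
    laurentDeriv μ (imagRay h t) (AddMonoidAlgebra.single a c) (Pi.single p 1) =
      c * μ ^ a.1 * (2 * Real.pi * Complex.I * a.2 p) *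
        (Real.exp (2 * Real.pi * t * linWeight h a.2) : ℂ) := by
  have h1 := ((hasFDerivAt_expChar a.2 (imagRay h t)).const_mul (μ ^ a.1)).const_mul c
  rw [laurentDeriv]
  simp only [laurentEval_single]
  rw [h1.fderiv, expChar_imagRay]
  simp only [smul_apply, sum_apply,
    ContinuousLinearMap.proj_apply, smul_eq_mul, Pi.single_apply]
  simp
  ring

open Classical in
lemma tendsto_laurentDeriv_imagRay {h : s → ℝ} {r : ℝ} (μ : ℂ) (p : s)
    {Q : AddMonoidAlgebra ℂ (ℕ × (s → ℤ))} (hQ : Q ∈ supportedIn {x | linWeight h x.2 < r}) :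
    Filter.Tendsto (fun t : ℝ => (Real.exp (-(2 * Real.pi * t * r)) : ℂ) *
      laurentDeriv μ (imagRay h t) Q (Pi.single p 1)) Filter.atTop (𝓝 0) := by
  have hsum : ∀ t, laurentDeriv μ (imagRay h t) Q (Pi.single p 1) =
      ∑ a ∈ Q.coeff.support, laurentDeriv μ (imagRay h t)
        (AddMonoidAlgebra.single a (Q.coeff a)) (Pi.single p 1) := by
    intro t
    let Φ : AddMonoidAlgebra ℂ (ℕ × (s → ℤ)) →+ ℂ :=
      AddMonoidHom.mk' (fun Q => laurentDeriv μ (imagRay h t) Q (Pi.single p 1))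
        fun Q Q' => by rw [laurentDeriv_add]; rfl
    have : Φ Q = Φ (Q.coeff.sum AddMonoidAlgebra.single) := by
      rw [AddMonoidAlgebra.sum_coeff_single]
    rw [Finsupp.sum, map_sum] at this
    exact this
  simp only [hsum, Finset.mul_sum]
  rw [show (0 : ℂ) = ∑ _a ∈ Q.coeff.support, 0 from Finset.sum_const_zero.symm]
  refine tendsto_finsetSum _ fun a ha => ?_
  have hlt : linWeight h a.2 < r := hQ a (Finsupp.mem_support_iff.mp ha)
  have hlim : Filter.Tendsto (fun t : ℝ => Real.exp (-(2 * Real.pi * (r - linWeight h a.2)) * t))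
      Filter.atTop (𝓝 0) := by
    refine Real.tendsto_exp_atBot.comp (Filter.tendsto_id.const_mul_atTop_of_neg ?_)
    have := mul_pos Real.two_pi_pos (sub_pos.mpr hlt)
    linarith
  have hlim' := ((Complex.continuous_ofReal.tendsto 0).comp hlim).const_mul
    (Q.coeff a * μ ^ a.1 * (2 * Real.pi * Complex.I * a.2 p))
  rw [Complex.ofReal_zero, mul_zero] at hlim'
  refine hlim'.congr fun t => ?_
  have hexp : Real.exp (-(2 * Real.pi * (r - linWeight h a.2)) * t) =
      Real.exp (-(2 * Real.pi * t * r)) * Real.exp (2 * Real.pi * t * linWeight h a.2) := by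
    rw [← Real.exp_add]
    congr 1
    ring
  rw [laurentDeriv_single_imagRay, Function.comp_apply, hexp, Complex.ofReal_mul]
  ring

/-- Scaling row `j` by `exp (-2 π t h_j)` normalizes the leading term of `Y j` and kills its lower
terms as `t → ∞`. The limit is `2 π i` times the identity for every `μ`, including `0`, since the
leading terms contain no `λ`. A determinant vanishing everywhere would contradict this. -/
lemma exists_jacobian_ne_zero [inst : DecidableEq s] {κ : ℝ} {θ h : s → ℝ}
    {Y : s → AddMonoidAlgebra ℂ (ℕ × (s → ℤ))}
    (hY : ∀ j, IsLeading κ θ h (Y j) (0, Pi.single j 1)) (μ : ℂ) :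
    ∃ x, jacobian (fun j x => laurentEval (Y j) (μ, x)) x ≠ 0 := by
  obtain rfl : inst = fun a b => Classical.propDecidable (a = b) := Subsingleton.elim _ _
  classical
  by_contra! hzero
  have hentry : ∀ j p, Filter.Tendsto (fun t : ℝ => (Real.exp (-(2 * Real.pi * t * h j)) : ℂ) *
      laurentDeriv μ (imagRay h t) (Y j) (Pi.single p 1)) Filter.atTop
      (𝓝 (((2 * Real.pi * Complex.I : ℂ) • (1 : Matrix s s ℂ)) j p)) := by
    intro j p
    have hlow : Y j - AddMonoidAlgebra.single (0, Pi.single j 1) 1 ∈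
        supportedIn {x | linWeight h x.2 < h j} := by
      refine supportedIn_mono ?_ (hY j)
      rintro x ⟨-, hx, -⟩
      rwa [linWeight_single] at hx
    have hlim := (tendsto_laurentDeriv_imagRay μ p hlow).add_const
      (((2 * Real.pi * Complex.I : ℂ) • (1 : Matrix s s ℂ)) j p)
    rw [zero_add] at hlim
    refine hlim.congr fun t => ?_
    have hsplit : laurentDeriv μ (imagRay h t) (Y j) (Pi.single p 1) =
        laurentDeriv μ (imagRay h t) (Y j - AddMonoidAlgebra.single (0, Pi.single j 1) 1)
          (Pi.single p 1) +
        laurentDeriv μ (imagRay h t) (AddMonoidAlgebra.single (0, Pi.single j 1) 1)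
          (Pi.single p 1) := by
      rw [← add_apply, ← laurentDeriv_add, sub_add_cancel]
    rw [hsplit, mul_add, laurentDeriv_single_imagRay, linWeight_single]
    congr 1
    rw [mul_left_comm, ← Complex.ofReal_mul, ← Real.exp_add, neg_add_cancel]
    simp [Matrix.one_apply, Pi.single_apply, eq_comm]
  have hmat : Filter.Tendsto (fun t : ℝ => Matrix.of fun j p : s =>
      (Real.exp (-(2 * Real.pi * t * h j)) : ℂ) *
        (Matrix.of fun j p => laurentDeriv μ (imagRay h t) (Y j) (Pi.single p 1)) j p)
      Filter.atTop (𝓝 ((2 * Real.pi * Complex.I : ℂ) • (1 : Matrix s s ℂ))) :=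
    tendsto_pi_nhds.mpr fun j => tendsto_pi_nhds.mpr fun p => hentry j p
  have hdet := ((continuous_id (X := Matrix s s ℂ)).matrix_det.tendsto _).comp hmat
  have hdet0 : ∀ t : ℝ, (Matrix.of fun j p : s => (Real.exp (-(2 * Real.pi * t * h j)) : ℂ) *
      (Matrix.of fun j p => laurentDeriv μ (imagRay h t) (Y j) (Pi.single p 1)) j p).det = 0 := by
    intro t
    rw [Matrix.det_mul_column]
    exact mul_eq_zero_of_right _ (hzero (imagRay h t))
  have hlim0 := tendsto_nhds_unique hdet
    ((tendsto_const_nhds (x := (0 : ℂ))).congr fun t => (hdet0 t).symm)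
  rw [id, Matrix.det_smul, Matrix.det_one, mul_one] at hlim0
  exact pow_ne_zero _ Complex.two_pi_I_ne_zero hlim0

end Jacobian

/-! ### Root systems in a Euclidean space -/

section Roots

variable {ι V N : Type*} [NormedAddCommGroup V] [InnerProductSpace ℝ V]
  [AddCommGroup N] [Module ℝ N] {P : RootPairing ι ℝ V N}

/-- The inner product as an invariant form of the root system. -/
def IsEuclidean.invariantForm (hP : IsEuclidean P) : P.InvariantForm where
  form := innerₗ V
  symm := ⟨fun v w => by simp [real_inner_comm]⟩
  ne_zero i := by simpa using P.ne_zero i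
  isOrthogonal_reflection i := fun v w => hP i v w

lemma inner_root_self_pos (P : RootPairing ι ℝ V N) (i : ι) : 0 < ⟪P.root i, P.root i⟫_ℝ :=
  real_inner_self_pos.mpr (P.ne_zero i)

lemma inner_coroot (v : V) (i : ι) :
    ⟪v, coroot P i⟫_ℝ = 2 * ⟪v, P.root i⟫_ℝ / ⟪P.root i, P.root i⟫_ℝ := by
  rw [coroot, real_inner_smul_right]
  ring

/-- Test orthogonality of the reflection against its own root, which it negates. -/
lemma IsEuclidean.coroot'_apply (hP : IsEuclidean P) (i : ι) (v : V) :
    P.coroot' i v = ⟪v, coroot P i⟫_ℝ := by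
  have h := hP i v (P.root i)
  rw [P.reflection_apply_self, P.reflection_apply, inner_neg_right, inner_sub_left,
    real_inner_smul_left] at h
  rw [inner_coroot, eq_div_iff (inner_root_self_pos P i).ne']
  linarith

lemma IsEuclidean.reflection_apply (hP : IsEuclidean P) (i : ι) (v : V) :
    P.reflection i v = v - ⟪v, coroot P i⟫_ℝ • P.root i := by
  rw [P.reflection_apply, hP.coroot'_apply]

lemma IsEuclidean.inner_root_coroot [P.IsCrystallographic] (hP : IsEuclidean P) (i j : ι) :
    ⟪P.root i, coroot P j⟫_ℝ = P.pairingIn ℤ i j := by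
  rw [← hP.coroot'_apply, P.root_coroot'_eq_pairing]
  exact (P.algebraMap_pairingIn ℤ i j).symm

lemma IsEuclidean.inner_smul_smul (hP : IsEuclidean P) (σ : P.weylGroup) (v w : V) :
    ⟪σ • v, σ • w⟫_ℝ = ⟪v, w⟫_ℝ :=
  RootPairing.InvariantForm.apply_weylGroup_smul P (B := hP.invariantForm) σ v w

lemma IsEuclidean.inner_smul_right (hP : IsEuclidean P) (σ : P.weylGroup) (v w : V) :
    ⟪v, σ • w⟫_ℝ = ⟪σ⁻¹ • v, w⟫_ℝ := by
  rw [← hP.inner_smul_smul σ (σ⁻¹ • v), smul_inv_smul]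

lemma inner_root_eq (v : V) (i : ι) :
    ⟪v, P.root i⟫_ℝ = ⟪v, coroot P i⟫_ℝ * (⟪P.root i, P.root i⟫_ℝ / 2) := by
  have := (inner_root_self_pos P i).ne'
  rw [inner_coroot]
  field_simp

/-! #### The Weyl group and the dominance order -/

section Dominance

variable (b : P.Base)

/-- A product of simple reflections. -/
def reflectionProd (l : List b.support) : V ≃ₗ[ℝ] V := (l.map fun i => P.reflection i).prod

/-- A product of simple reflections as a permutation of the roots. -/
def permProd (l : List b.support) : Equiv.Perm ι := (l.map fun i => P.reflectionPerm i).prod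

variable {b}

lemma reflectionProd_cons (i : b.support) (l : List b.support) :
    reflectionProd b (i :: l) = P.reflection i * reflectionProd b l := by
  simp [reflectionProd]

lemma reflectionProd_append (l l' : List b.support) :
    reflectionProd b (l ++ l') = reflectionProd b l * reflectionProd b l' := by
  simp [reflectionProd]

lemma permProd_cons (i : b.support) (l : List b.support) :
    permProd b (i :: l) = P.reflectionPerm i * permProd b l := by
  simp [permProd]

lemma reflection_mul_self (i : ι) : P.reflection i * P.reflection i = 1 := by
  rw [← sq, P.reflection_sq]

lemma root_permProd (l : List b.support) (i : ι) :
    P.root (permProd b l i) = reflectionProd b l (P.root i) := by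
  induction l with
  | nil => rfl
  | cons j l ih =>
    rw [permProd_cons, reflectionProd_cons, Equiv.Perm.mul_apply, P.root_reflectionPerm, ih]
    rfl

/-- Conjugating a reflection by `w` gives the reflection in the image root: `w s_α = s_{wα} w`. -/
lemma reflectionProd_mul_reflection (l : List b.support) (i : ι) :
    reflectionProd b l * P.reflection i =
      P.reflection (permProd b l i) * reflectionProd b l := by
  induction l with
  | nil => simp [reflectionProd, permProd]
  | cons j l ih =>
    rw [permProd_cons, reflectionProd_cons, Equiv.Perm.mul_apply, P.reflection_reflectionPerm,
      mul_assoc, ih]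
    simp only [mul_assoc]
    rw [← mul_assoc (P.reflection (j : ι)) (P.reflection (j : ι)), reflection_mul_self, one_mul]

variable [Finite ι] [P.IsCrystallographic] [P.IsReduced]

/-- The exchange property: if a product of simple reflections maps the simple root `α_j` to a
negative root, then its product with the reflection of `α_j` is a shorter product. -/
lemma exists_shorter_of_not_isPos (l : List b.support) (j : b.support)
    (h : ¬ b.IsPos (permProd b l j)) :
    ∃ l' : List b.support, l'.length < l.length ∧
      reflectionProd b l' = reflectionProd b l * P.reflection j := by
  induction l with
  | nil => exact absurd (RootPairing.Base.isPos_of_mem_support j.2) h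
  | cons i l ih =>
    by_cases hl : b.IsPos (permProd b l j)
    · refine ⟨l, by simp, ?_⟩
      -- The reflection of `α_i` makes no positive root other than `α_i` negative. Once the image of
      -- `α_j` is `α_i`, the two copies of that reflection cancel.
      have hi : permProd b l j = i := by
        by_contra hne
        apply h
        rw [permProd_cons, Equiv.Perm.mul_apply]
        exact hl.reflectionPerm i.2 hne
      rw [reflectionProd_cons, mul_assoc, reflectionProd_mul_reflection, hi, ← mul_assoc,
        reflection_mul_self, one_mul]
    · obtain ⟨l', hlen, hl'⟩ := ih hl
      refine ⟨i :: l', by simpa using hlen, ?_⟩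
      rw [reflectionProd_cons, reflectionProd_cons, hl', mul_assoc]

lemma exists_reflectionProd_eq_reflection (i : ι) :
    ∃ l : List b.support, reflectionProd b l = P.reflection i := by
  induction i using b.induction_reflect with
  | h₀ i ih =>
    obtain ⟨l, hl⟩ := ih
    -- The negative root is the image of the root under its own reflection, so conjugation produces
    -- a triple product.
    refine ⟨l ++ (l ++ l), ?_⟩
    rw [P.reflection_reflectionPerm, reflectionProd_append, reflectionProd_append, hl, mul_assoc]
  | h₁ i hi => exact ⟨[⟨i, hi⟩], by simp [reflectionProd]⟩
  | h₂ i j ih hj =>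
    obtain ⟨l, hl⟩ := ih
    refine ⟨⟨j, hj⟩ :: (l ++ [⟨j, hj⟩]), ?_⟩
    rw [P.reflection_reflectionPerm, reflectionProd_cons, reflectionProd_append, hl, mul_assoc]
    simp [reflectionProd]

variable (b) in
/-- The Weyl group consists of the products of simple reflections. -/
lemma exists_reflectionProd_eq_smul (σ : P.weylGroup) :
    ∃ l : List b.support, ∀ v : V, σ • v = reflectionProd b l v := by
  obtain ⟨g, hg⟩ := σ
  induction hg using RootPairing.weylGroup.induction with
  | mem i =>
    obtain ⟨l, hl⟩ := exists_reflectionProd_eq_reflection (b := b) i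
    exact ⟨l, fun v => by rw [hl]; rfl⟩
  | one => exact ⟨[], fun v => rfl⟩
  | mul x y hx hy hx' hy' =>
    obtain ⟨l, hl⟩ := hx'
    obtain ⟨l', hl'⟩ := hy'
    refine ⟨l ++ l', fun v => ?_⟩
    rw [reflectionProd_append, LinearEquiv.mul_apply, ← hl', ← hl]
    exact mul_smul x y v

variable (b) in
/-- The cone of the combinations of simple roots with coefficients in `ℕ`. -/
def posCone : AddSubmonoid V := AddSubmonoid.closure (P.root '' b.support)

omit [P.IsReduced] in
lemma root_mem_posCone {i : ι} (hi : b.IsPos i) : P.root i ∈ posCone b := by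
  refine hi.induction_on_add (p := fun i => P.root i ∈ posCone b)
    (fun i hi => AddSubmonoid.subset_closure ⟨i, hi, rfl⟩) fun i j k hk ih hj => ?_
  rw [hk]
  exact add_mem ih (AddSubmonoid.subset_closure ⟨j, hj, rfl⟩)

/-- A dominant weight is at least as large as its images under the Weyl group. -/
lemma sub_reflectionProd_mem_posCone (hP : IsEuclidean P) {u : V}
    (hu : ∀ j : b.support, ∃ n : ℕ, ⟪u, coroot P j⟫_ℝ = n) (l : List b.support) :
    u - reflectionProd b l u ∈ posCone b := by
  induction hn : l.length using Nat.strong_induction_on generalizing l with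
  | _ n ih =>
    rcases List.eq_nil_or_concat l with rfl | ⟨l, j, rfl⟩
    · simp [reflectionProd]
    · have happ : reflectionProd b (l.concat j) = reflectionProd b l * P.reflection j := by
        rw [List.concat_eq_append, reflectionProd_append]
        simp [reflectionProd]
      rw [List.length_concat] at hn
      -- For a word `w s_j` with `w α_j` positive, `u - w s_j u` is `u - w u` plus a natural
      -- multiple of `w α_j`. Otherwise the exchange property supplies a shorter word for the same
      -- element.
      by_cases hpos : b.IsPos (permProd b l j)
      · obtain ⟨c, hc⟩ := hu j
        have : u - reflectionProd b (l.concat j) u =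
            (u - reflectionProd b l u) + c • P.root (permProd b l j) := by
          rw [happ, LinearEquiv.mul_apply, hP.reflection_apply, hc, map_sub, map_smul,
            root_permProd, Nat.cast_smul_eq_nsmul]
          abel
        rw [this]
        exact add_mem (ih l.length (by omega) l rfl) (nsmul_mem (root_mem_posCone hpos) _)
      · obtain ⟨l', hlen, hl'⟩ := exists_shorter_of_not_isPos l j hpos
        rw [happ, ← hl']
        exact ih l'.length (by omega) l' rfl

lemma sub_smul_mem_posCone (hP : IsEuclidean P) {u : V}
    (hu : ∀ j : b.support, ∃ n : ℕ, ⟪u, coroot P j⟫_ℝ = n) (σ : P.weylGroup) :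
    u - σ • u ∈ posCone b := by
  obtain ⟨l, hl⟩ := exists_reflectionProd_eq_smul b σ
  rw [hl]
  exact sub_reflectionProd_mem_posCone hP hu l

end Dominance

/-! #### Fundamental weights -/

section Weights

variable [P.IsRootSystem] (b : P.Base) [FiniteDimensional ℝ V]

open Classical in
lemma sum_inner_fundWeight_smul_coroot (v : V) :
    ∑ j : b.support, ⟪fundWeight b j, v⟫_ℝ • coroot P j = v := by
  have h := (corootBasis b).sum_repr v
  conv_rhs => rw [← h]
  refine Finset.sum_congr rfl fun j _ => ?_
  rw [corootBasis_apply]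
  congr 1
  conv_lhs => rw [← h]
  simp only [inner_sum, real_inner_smul_right, corootBasis_apply, inner_fundWeight_coroot]
  simp

lemma inner_eq_sum (v w : V) :
    ⟪v, w⟫_ℝ = ∑ j : b.support, ⟪v, coroot P j⟫_ℝ * ⟪fundWeight b j, w⟫_ℝ := by
  conv_lhs => rw [← sum_inner_fundWeight_smul_coroot b w]
  rw [inner_sum]
  exact Finset.sum_congr rfl fun j _ => by rw [real_inner_smul_right, mul_comm]

lemma eq_of_inner_coroot {v w : V} (h : ∀ j : b.support, ⟪v, coroot P j⟫_ℝ = ⟪w, coroot P j⟫_ℝ) :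
    v = w :=
  ext_inner_right ℝ fun u => by
    rw [inner_eq_sum b v, inner_eq_sum b w]
    exact Finset.sum_congr rfl fun j _ => by rw [h]

lemma inner_point (m : b.support → ℕ) (v : V) (p : (b.support → ℝ) × ℝ) :
    ⟪v, point b m p⟫_ℝ = p.2 * ⟪v, weight b m⟫_ℝ + ∑ j, p.1 j * ⟪v, coroot P j⟫_ℝ := by
  simp only [point, inner_add_right, real_inner_smul_right, inner_sum]

lemma exists_point_eq (m : b.support → ℕ) (v : V) (c : ℝ) : ∃ x, point b m (x, c) = v := by
  refine ⟨fun j => ⟪fundWeight b j, v - c • weight b m⟫_ℝ, ?_⟩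
  rw [point, sum_inner_fundWeight_smul_coroot]
  simp

open Classical in
lemma inner_weight_coroot (m : b.support → ℕ) (j : b.support) :
    ⟪weight b m, coroot P j⟫_ℝ = m j := by
  simp only [weight, sum_inner, real_inner_smul_left, inner_fundWeight_coroot]
  simp

omit [FiniteDimensional ℝ V] in
/-- The vectors with nonnegative pairings with the simple roots are nonnegative on each other. -/
lemma inner_nonneg_of_dominant [Finite ι] [P.IsCrystallographic] (hP : IsEuclidean P) {v w : V}
    (hv : ∀ j : b.support, 0 ≤ ⟪v, P.root j⟫_ℝ) (hw : ∀ j : b.support, 0 ≤ ⟪w, P.root j⟫_ℝ) :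
    0 ≤ ⟪v, w⟫_ℝ := by
  have hnonpos : ∀ i j : b.support, i ≠ j → ⟪P.root i, P.root j⟫_ℝ ≤ 0 := by
    intro i j hij
    rw [inner_root_eq, hP.inner_root_coroot]
    have h1 : P.pairingIn ℤ (i : ι) j ≤ 0 :=
      b.pairingIn_le_zero_of_ne (fun h => hij (Subtype.ext h)) i.2 j.2
    have h2 := inner_root_self_pos P (j : ι)
    have h3 : (P.pairingIn ℤ (i : ι) j : ℝ) ≤ 0 := by exact_mod_cast h1
    exact mul_nonpos_of_nonpos_of_nonneg h3 (by positivity)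
  set c : b.support → ℝ := fun j => b.toWeightBasis.repr w j with hc
  have hsum : w = ∑ j, c j • P.root j := by
    conv_lhs => rw [← b.toWeightBasis.sum_repr w]
    simp [hc]
  -- Write `w = w₊ - w'` with disjointly supported nonnegative parts. Distinct simple roots form
  -- nonacute angles, so `(w₊, w') ≤ 0`, while `(w, w') ≥ 0` by dominance. Hence `(w', w') ≤ 0`.
  have hneg : ∑ j, max (-c j) 0 • P.root (j : ι) = 0 := by
    set w' := ∑ j, max (-c j) 0 • P.root (j : ι) with hw'
    have h1 : w' = ∑ j, max (c j) 0 • P.root (j : ι) - w := by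
      rw [hsum, ← Finset.sum_sub_distrib, hw']
      refine Finset.sum_congr rfl fun j _ => ?_
      rw [← sub_smul]
      congr 1
      rcases le_total (c j) 0 with h | h
      · rw [max_eq_left (by linarith), max_eq_right h]
        ring
      · rw [max_eq_right (by linarith), max_eq_left h]
        ring
    have h2 : 0 ≤ ⟪w, w'⟫_ℝ := by
      rw [hw', inner_sum]
      refine Finset.sum_nonneg fun j _ => ?_
      rw [real_inner_smul_right]
      exact mul_nonneg (le_max_right _ _) (hw j)
    have h3 : ⟪∑ j, max (c j) 0 • P.root (j : ι), w'⟫_ℝ ≤ 0 := by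
      rw [hw', sum_inner]
      refine Finset.sum_nonpos fun i _ => ?_
      rw [inner_sum]
      refine Finset.sum_nonpos fun j _ => ?_
      rw [real_inner_smul_left, real_inner_smul_right]
      by_cases hij : i = j
      · subst hij
        rcases le_total (c i) 0 with h | h
        · rw [max_eq_right h, zero_mul]
        · rw [max_eq_right (by linarith : -c i ≤ 0), zero_mul, mul_zero]
      · exact mul_nonpos_of_nonneg_of_nonpos (le_max_right _ _)
          (mul_nonpos_of_nonneg_of_nonpos (le_max_right _ _) (hnonpos i j hij))
    have h4 : ⟪w', w'⟫_ℝ ≤ 0 := by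
      conv_lhs => rw [h1, inner_sub_left]
      rw [← h1]
      linarith
    exact real_inner_self_nonpos.mp h4
  have hc0 : ∀ j, 0 ≤ c j := by
    intro j
    have hli := Fintype.linearIndependent_iff.mp b.toWeightBasis.linearIndependent
      (fun j => max (-c j) 0) (by simpa using hneg) j
    have := le_max_left (-c j) 0
    change max (-c j) 0 = 0 at hli
    linarith
  rw [hsum, inner_sum]
  refine Finset.sum_nonneg fun j _ => ?_
  rw [real_inner_smul_right]
  exact mul_nonneg (hc0 j) (hv j)

open Classical in
lemma inner_fundWeight_root_nonneg (i j : b.support) : 0 ≤ ⟪fundWeight b i, P.root j⟫_ℝ := by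
  rw [inner_root_eq, inner_fundWeight_coroot]
  have := inner_root_self_pos P (j : ι)
  split_ifs <;> positivity

lemma inner_weight_root (m : b.support → ℕ) (j : b.support) :
    ⟪weight b m, P.root j⟫_ℝ = m j * (⟪P.root j, P.root j⟫_ℝ / 2) := by
  rw [inner_root_eq, inner_weight_coroot]

lemma inner_weight_root_nonneg (m : b.support → ℕ) (j : b.support) :
    0 ≤ ⟪weight b m, P.root j⟫_ℝ := by
  rw [inner_weight_root]
  have := inner_root_self_pos P (j : ι)
  positivity

/-- The heights `(ω_j, ρ)` of the fundamental weights, with `ρ = ∑ ω_i`. -/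
def weightHeight (j : b.support) : ℝ := ⟪fundWeight b j, weight b 1⟫_ℝ

variable [Finite ι] [P.IsCrystallographic]

lemma theta_nonneg (hP : IsEuclidean P) (m : b.support → ℕ) (j : b.support) : 0 ≤ theta b m j :=
  inner_nonneg_of_dominant b hP (inner_fundWeight_root_nonneg b j) (inner_weight_root_nonneg b m)

-- The summand `(ω_j, ω_j)` of `(ω_j, ρ)` is positive and the other summands are nonnegative.
open Classical in
lemma weightHeight_pos (hP : IsEuclidean P) (j : b.support) : 0 < weightHeight b j := by
  have h1 : ∀ i, 0 ≤ ⟪fundWeight b j, fundWeight b i⟫_ℝ := fun i =>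
    inner_nonneg_of_dominant b hP (inner_fundWeight_root_nonneg b j)
      (inner_fundWeight_root_nonneg b i)
  have h2 : 0 < ⟪fundWeight b j, fundWeight b j⟫_ℝ := by
    refine real_inner_self_pos.mpr fun h0 => ?_
    have := inner_fundWeight_coroot b j j
    rw [h0, inner_zero_left, if_pos rfl] at this
    exact zero_ne_one this
  rw [weightHeight, weight, inner_sum]
  simp only [Pi.one_apply, Nat.cast_one, one_smul]
  exact h2.trans_le (Finset.single_le_sum (f := fun i => ⟪fundWeight b j, fundWeight b i⟫_ℝ)
    (fun i _ => h1 i) (Finset.mem_univ j))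

/-- The number `κ` is positive and every `(ω, α_r)` is an integral multiple of it. -/
lemma kappa_spec [P.IsReduced] [P.IsIrreducible] (hP : IsEuclidean P) {m : b.support → ℕ}
    (hm : m ≠ 0) : 0 < kappa b m ∧
      ∀ r : b.support, ∃ n : ℤ, ⟪weight b m, P.root r⟫_ℝ = n * kappa b m := by
  set S := {t : ℝ | ∀ r : b.support, ∃ n : ℤ, ⟪weight b m, P.root r⟫_ℝ = n * t} with hS
  obtain ⟨r₀, hr₀⟩ := Function.ne_iff.mp hm
  have hv : 0 < ⟪weight b m, P.root r₀⟫_ℝ := by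
    rw [inner_weight_root]
    have h1 : (0 : ℝ) < m r₀ := by exact_mod_cast Nat.pos_of_ne_zero hr₀
    have h2 := inner_root_self_pos P (r₀ : ι)
    positivity
  set v := ⟪weight b m, P.root r₀⟫_ℝ with hvdef
  have hSpos : ∃ t ∈ S, 0 < t := by
    -- By irreducibility, squared root lengths have ratio 1, 2, 3, 1/2 or 1/3. The 12 absorbs these
    -- denominators and the factor 1/2 in `(ω, α_r) = m_r (α_r, α_r) / 2`.
    refine ⟨⟪P.root r₀, P.root r₀⟫_ℝ / 12, fun r => ?_, by
      have := inner_root_self_pos P (r₀ : ι)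
      positivity⟩
    rw [inner_weight_root]
    have := hP.invariantForm.apply_eq_or (r : ι) r₀
    change ⟪P.root r, P.root r⟫_ℝ = ⟪P.root r₀, P.root r₀⟫_ℝ ∨
      ⟪P.root r, P.root r⟫_ℝ = 2 * ⟪P.root r₀, P.root r₀⟫_ℝ ∨
      ⟪P.root r, P.root r⟫_ℝ = 3 * ⟪P.root r₀, P.root r₀⟫_ℝ ∨
      ⟪P.root r₀, P.root r₀⟫_ℝ = 2 * ⟪P.root r, P.root r⟫_ℝ ∨
      ⟪P.root r₀, P.root r₀⟫_ℝ = 3 * ⟪P.root r, P.root r⟫_ℝ at this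
    rcases this with h | h | h | h | h
    · exact ⟨6 * m r, by rw [h]; push_cast; ring⟩
    · exact ⟨12 * m r, by rw [h]; push_cast; ring⟩
    · exact ⟨18 * m r, by rw [h]; push_cast; ring⟩
    · exact ⟨3 * m r, by rw [h]; push_cast; ring⟩
    · exact ⟨2 * m r, by rw [h]; push_cast; ring⟩
  obtain ⟨t₀, ht₀, ht₀pos⟩ := hSpos
  have hform : ∀ t ∈ S, 0 < t → ∃ n : ℕ, 0 < n ∧ t = v / n := by
    intro t ht htpos
    obtain ⟨n, hn⟩ := ht r₀
    have hnpos : (0 : ℝ) < n := by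
      by_contra hle
      have := mul_nonpos_of_nonpos_of_nonneg (not_lt.mp hle) htpos.le
      linarith
    have hn0 : 0 < n := by exact_mod_cast hnpos
    refine ⟨n.toNat, by omega, ?_⟩
    have hcast : ((n.toNat : ℕ) : ℝ) = n := by exact_mod_cast Int.toNat_of_nonneg hn0.le
    rw [hcast, eq_div_iff hnpos.ne', hvdef, hn]
    ring
  -- Positive common divisors are of the form `v / n`, so only finitely many are at least `t₀`;
  -- hence the supremum defining `κ` is attained.
  have hfin : (S ∩ Set.Ici t₀).Finite := by
    refine ((Set.finite_Iic ⌈v / t₀⌉₊).image fun n : ℕ => v / (n : ℝ)).subset ?_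
    rintro t ⟨ht, htt⟩
    have htpos : 0 < t := ht₀pos.trans_le htt
    obtain ⟨n, hn, rfl⟩ := hform t ht htpos
    refine ⟨n, ?_, rfl⟩
    have hn' : (0 : ℝ) < n := by exact_mod_cast hn
    have : (n : ℝ) ≤ v / t₀ := by
      rw [le_div_iff₀ ht₀pos]
      have := (le_div_iff₀ hn').mp (Set.mem_Ici.mp htt)
      linarith
    exact_mod_cast this.trans (Nat.le_ceil _)
  obtain ⟨t₁, ⟨ht₁, ht₀₁⟩, hmax⟩ := Set.exists_max_image _ id hfin ⟨t₀, ht₀, Set.mem_Ici.mpr le_rfl⟩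
  have hgreatest : IsGreatest S t₁ := by
    refine ⟨ht₁, fun t ht => ?_⟩
    rcases le_total t₀ t with h | h
    · exact hmax t ⟨ht, h⟩
    · exact h.trans ht₀₁
  have hk : kappa b m = t₁ := hgreatest.csSup_eq
  rw [hk]
  exact ⟨ht₀pos.trans_le ht₀₁, ht₁⟩

end Weights

end Roots

/-! ### Invariant Laurent polynomials -/

section Invariants

variable {ι V N : Type*} [NormedAddCommGroup V] [InnerProductSpace ℝ V] [FiniteDimensional ℝ V]
  [AddCommGroup N] [Module ℝ N] {P : RootPairing ι ℝ V N} [P.IsRootSystem] (b : P.Base)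

/-- The weight `∑ k_j ω_j` with integral coordinates `k`. -/
def intWeight (k : b.support → ℤ) : V := ∑ j, (k j : ℝ) • fundWeight b j

open Classical in
lemma inner_intWeight_coroot (k : b.support → ℤ) (j : b.support) :
    ⟪intWeight b k, coroot P j⟫_ℝ = k j := by
  simp only [intWeight, sum_inner, real_inner_smul_left, inner_fundWeight_coroot]
  simp

lemma intWeight_injective : Function.Injective (intWeight b) := fun k k' h => funext fun j => by
  have := inner_intWeight_coroot b k j
  rw [h, inner_intWeight_coroot] at this
  exact_mod_cast this.symm

lemma inner_intWeight (k : b.support → ℤ) (w : V) :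
    ⟪intWeight b k, w⟫_ℝ = linWeight (fun j => ⟪fundWeight b j, w⟫_ℝ) k := by
  simp only [intWeight, sum_inner, real_inner_smul_left, linWeight]

open Classical in
lemma intWeight_single (j : b.support) : intWeight b (Pi.single j 1) = fundWeight b j := by
  simp [intWeight, Pi.single_apply]

/-! ### Characters indexed by degree and weight -/

variable (m : b.support → ℕ)

/-- The character `exp (2 π i ((β, 𝐱) - d c))` of the group of all `(x; c)`. -/
def weightChar (y : ℝ × V) : Multiplicative ((b.support → ℝ) × ℝ) →* ℂ where
  toFun p := Complex.exp (2 * Real.pi * Complex.I *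
    (⟪y.2, point b m p.toAdd⟫_ℝ - y.1 * p.toAdd.2 : ℝ))
  map_one' := by simp [inner_point]
  map_mul' p p' := by
    rw [← Complex.exp_add]
    congr 1
    simp only [inner_point, toAdd_mul, Prod.fst_add, Prod.snd_add, Pi.add_apply, add_mul,
      Finset.sum_add_distrib]
    push_cast
    ring

lemma weightChar_ofAdd (y : ℝ × V) (p : (b.support → ℝ) × ℝ) :
    weightChar b m y (.ofAdd p) = Complex.exp (2 * Real.pi * Complex.I *
      (⟪y.2, point b m p⟫_ℝ - y.1 * p.2 : ℝ)) := rfl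

/-- The point `𝐱` and the value of `c` can be prescribed independently, so the weight is detected at
`c = 0` and the degree at `𝐱 = 0`. -/
lemma weightChar_injective : Function.Injective (weightChar b m) := by
  rintro ⟨d, v⟩ ⟨d', v'⟩ h
  have h' : ∀ p : (b.support → ℝ) × ℝ, weightChar b m (d, v) (.ofAdd p) =
      weightChar b m (d', v') (.ofAdd p) := fun p => by rw [h]
  have hv : v = v' := by
    refine ext_inner_right ℝ fun u => ?_
    by_contra hne
    obtain ⟨t, ht⟩ := exists_exp_ne hne
    obtain ⟨x, hx⟩ := exists_point_eq b m (t • u) 0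
    apply ht
    have := h' (x, 0)
    simpa only [weightChar_ofAdd, hx, real_inner_smul_right, mul_zero, sub_zero, mul_comm t]
      using this
  subst hv
  refine Prod.ext ?_ rfl
  by_contra hne
  obtain ⟨t, ht⟩ := exists_exp_ne (neg_injective.ne hne)
  obtain ⟨x, hx⟩ := exists_point_eq b m 0 t
  apply ht
  have := h' (x, t)
  simpa only [weightChar_ofAdd, hx, inner_zero_right, zero_sub, ← neg_mul] using this

/-- The character of the exponent `(a, k)`, as a degree and a weight. -/
def toWeight (y : ℕ × (b.support → ℤ)) : ℝ × V :=
  (expDegree (kappa b m) (theta b m) y, intWeight b y.2)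

lemma toWeight_injective (hκ : kappa b m ≠ 0) : Function.Injective (toWeight b m) := by
  rintro ⟨a, k⟩ ⟨a', k'⟩ h
  simp only [toWeight, Prod.mk.injEq, expDegree] at h
  obtain rfl := intWeight_injective b h.2
  have h1 := mul_left_cancel₀ hκ (add_right_cancel h.1)
  exact Prod.ext (by exact_mod_cast h1) rfl

/-- A Laurent polynomial as a function of `(x; c)`. -/
def evalPoint (Q : AddMonoidAlgebra ℂ (ℕ × (b.support → ℤ))) : (b.support → ℝ) × ℝ → ℂ :=
  fun p => laurentEval Q (lam (kappa b m) p, fun j => (p.1 j : ℂ))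

/-- The part `c ω` of `𝐱` contributes `c (β, ω)`, which the degree cancels up to `-κ a c`, the
exponent of `λ^a`. In these terms the Weyl group acts on the weight alone. -/
lemma weightChar_toWeight (y : ℕ × (b.support → ℤ)) (p : (b.support → ℝ) × ℝ) :
    weightChar b m (toWeight b m y) (.ofAdd p) = character (kappa b m) y (.ofAdd p) := by
  rw [weightChar_ofAdd]
  simp only [toWeight, inner_point, expDegree, inner_intWeight_coroot]
  rw [inner_intWeight]
  change _ = mono _ _ p
  simp only [mono]
  congr 3
  change p.2 * linWeight (theta b m) y.2 + _ - _ = _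
  simp only [mul_comm (p.1 _)]
  ring

lemma evalPoint_eq (Q : AddMonoidAlgebra ℂ (ℕ × (b.support → ℤ))) (p : (b.support → ℝ) × ℝ) :
    evalPoint b m Q p = Finsupp.linearCombination ℂ
      (fun y => (weightChar b m y : _ → ℂ)) (Q.coeff.mapDomain (toWeight b m)) (.ofAdd p) := by
  rw [evalPoint, laurentEval_eq, Finsupp.linearCombination_mapDomain]
  simp only [Finsupp.linearCombination_apply, Finsupp.sum, Finset.sum_apply, Pi.smul_apply,
    Function.comp_apply, weightChar_toWeight]

lemma linearIndependent_weightChar : LinearIndependent ℂ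
    (fun y => (weightChar b m y : Multiplicative ((b.support → ℝ) × ℝ) → ℂ)) :=
  (linearIndependent_monoidHom _ ℂ).comp _ (weightChar_injective b m)

/-- The Laurent polynomials that represent invariant functions. -/
def invariantLaurent : Subalgebra ℂ (AddMonoidAlgebra ℂ (ℕ × (b.support → ℤ))) where
  carrier := {Q | IsInvariant b m (evalPoint b m Q)}
  mul_mem' := fun {Q Q'} hQ hQ' σ k x x' c h => by
    have h1 := hQ σ k x x' c h
    have h2 := hQ' σ k x x' c h
    simp only [evalPoint, map_mul, Pi.mul_apply] at h1 h2 ⊢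
    rw [h1, h2]
  add_mem' := fun {Q Q'} hQ hQ' σ k x x' c h => by
    have h1 := hQ σ k x x' c h
    have h2 := hQ' σ k x x' c h
    simp only [evalPoint, map_add, Pi.add_apply] at h1 h2 ⊢
    rw [h1, h2]
  algebraMap_mem' := fun r σ k x x' c h => by
    simp only [evalPoint, AlgHom.commutes]
    rfl

lemma lamVar_mem_invariantLaurent : lamVar ∈ invariantLaurent b m := fun σ k x x' c h => by
  simp only [evalPoint, laurentEval_lamVar, lam, mono]
  simp

/-- An exponent of an invariant Laurent polynomial with a negative coordinate is not of maximal
height, because a simple reflection increases its height. -/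
lemma exists_higher_exponent (hP : IsEuclidean P) (hκ : kappa b m ≠ 0)
    {Q : AddMonoidAlgebra ℂ (ℕ × (b.support → ℤ))} (hQ : Q ∈ invariantLaurent b m)
    {x : ℕ × (b.support → ℤ)} (hx : Q.coeff x ≠ 0) {i : b.support} (hi : x.2 i < 0) :
    ∃ y, Q.coeff y ≠ 0 ∧ linWeight (weightHeight b) x.2 < linWeight (weightHeight b) y.2 := by
  classical
  set σ : P.weylGroup := RootPairing.weylGroup.ofIdx P (i : ι) with hσ
  have hinv : ∀ v : V, σ⁻¹ • v = P.reflection i v := fun v => by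
    rw [inv_smul_eq_iff]
    change v = (P.reflection i * P.reflection i) v
    rw [reflection_mul_self]
    rfl
  have hrefl : Function.Injective fun y : ℝ × V => (y.1, P.reflection i y.2) := by
    rintro ⟨d, v⟩ ⟨d', v'⟩ h
    simp only [Prod.mk.injEq, EmbeddingLike.apply_eq_iff_eq] at h
    exact Prod.ext h.1 h.2
  have hinj := hrefl.comp (toWeight_injective b m hκ)
  -- Invariance and independence of characters force the coefficients to be symmetric under the
  -- simple reflection at fixed degree.
  have heq : Q.coeff.mapDomain ((fun y : ℝ × V => (y.1, P.reflection i y.2)) ∘ toWeight b m) =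
      Q.coeff.mapDomain (toWeight b m) := by
    refine linearIndependent_weightChar b m (funext fun p => ?_)
    obtain ⟨x', hx'⟩ := exists_point_eq b m (σ • point b m p.toAdd) p.toAdd.2
    have h1 := hQ σ 0 p.toAdd.1 x' p.toAdd.2 (by simpa using hx')
    rw [evalPoint_eq, evalPoint_eq] at h1
    refine Eq.trans ?_ h1
    rw [Finsupp.linearCombination_mapDomain, Finsupp.linearCombination_mapDomain]
    simp only [Finsupp.linearCombination_apply, Finsupp.sum, Finset.sum_apply, Pi.smul_apply,
      Function.comp_apply]
    refine Finset.sum_congr rfl fun y _ => ?_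
    congr 1
    rw [weightChar_ofAdd, hx', hP.inner_smul_right, hinv]
    rfl
  have hne : (Q.coeff.mapDomain (toWeight b m))
      ((toWeight b m x).1, P.reflection i (toWeight b m x).2) ≠ 0 := by
    rw [← heq]
    have := Finsupp.mapDomain_apply hinj Q.coeff x
    rw [Function.comp_apply] at this
    rwa [this]
  obtain ⟨y, hy, hyx⟩ := Finset.mem_image.mp
    (Finsupp.mapDomain_support (Finsupp.mem_support_iff.mpr hne))
  refine ⟨y, Finsupp.mem_support_iff.mp hy, ?_⟩
  have hw : intWeight b y.2 = P.reflection i (intWeight b x.2) := congrArg Prod.snd hyx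
  have hlin : ∀ k, linWeight (weightHeight b) k = ⟪intWeight b k, weight b 1⟫_ℝ := fun k =>
    (inner_intWeight b k _).symm
  -- Reflection changes the height by `-k_i (α_i, ρ) = -k_i (α_i, α_i) / 2`, which is positive.
  rw [hlin, hlin, hw, hP.reflection_apply, inner_sub_left, real_inner_smul_left,
    inner_intWeight_coroot, real_inner_comm (weight b 1) (P.root i), inner_weight_root]
  have h1 := inner_root_self_pos P (i : ι)
  have h2 : ((x.2 i : ℤ) : ℝ) < 0 := by exact_mod_cast hi
  simp only [Pi.one_apply, Nat.cast_one, one_mul]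
  have := mul_neg_of_neg_of_pos h2 (half_pos h1)
  linarith

/-! ### The basic generators -/

section BasicGenerators

variable [Finite ι] [P.IsCrystallographic] [P.IsReduced] [P.IsIrreducible]

variable {m}

/-- The pairings of an element of the cone of the simple roots with `ω`, the simple coroots
and `ρ`. -/
lemma posCone_spec (hP : IsEuclidean P) (hm : m ≠ 0) {u : V} (hu : u ∈ posCone b) :
    (∃ n : ℕ, ⟪u, weight b m⟫_ℝ = n * kappa b m) ∧
    (∀ j : b.support, ∃ n : ℤ, ⟪u, coroot P j⟫_ℝ = n) ∧
    (u ≠ 0 → 0 < ⟪u, weight b 1⟫_ℝ) := by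
  obtain ⟨hκ, hmul⟩ := kappa_spec b hP hm
  induction hu using AddSubmonoid.closure_induction with
  | mem u hu =>
    obtain ⟨i, hi, rfl⟩ := hu
    refine ⟨?_, fun j => ⟨_, hP.inner_root_coroot i j⟩, fun _ => ?_⟩
    · obtain ⟨n, hn⟩ := hmul ⟨i, hi⟩
      have h0 := inner_weight_root_nonneg b m ⟨i, hi⟩
      rw [hn] at h0
      have hn0 : 0 ≤ n := by
        have : (0 : ℝ) ≤ n := nonneg_of_mul_nonneg_left h0 hκ
        exact_mod_cast this
      refine ⟨n.toNat, ?_⟩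
      rw [real_inner_comm, hn]
      congr 1
      exact_mod_cast (Int.toNat_of_nonneg hn0).symm
    · have h1 := inner_weight_root b 1 ⟨i, hi⟩
      have h2 := inner_root_self_pos P i
      rw [real_inner_comm, h1]
      simp only [Pi.one_apply, Nat.cast_one, one_mul]
      positivity
  | zero => exact ⟨⟨0, by simp⟩, fun j => ⟨0, by simp⟩, fun h => absurd rfl h⟩
  | add u v _ _ hu hv =>
    obtain ⟨⟨n, hn⟩, hu2, hu3⟩ := hu
    obtain ⟨⟨n', hn'⟩, hv2, hv3⟩ := hv
    refine ⟨⟨n + n', ?_⟩, fun j => ?_, fun h => ?_⟩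
    · rw [inner_add_left, hn, hn']
      push_cast
      ring
    · obtain ⟨k, hk⟩ := hu2 j
      obtain ⟨k', hk'⟩ := hv2 j
      exact ⟨k + k', by rw [inner_add_left, hk, hk', Int.cast_add]⟩
    · rw [inner_add_left]
      by_cases hu0 : u = 0
      · subst hu0
        rw [zero_add] at h
        rw [inner_zero_left, zero_add]
        exact hv3 h
      · by_cases hv0 : v = 0
        · subst hv0
          rw [inner_zero_left, add_zero]
          exact hu3 hu0
        · exact add_pos (hu3 hu0) (hv3 hv0)

open Classical in
/-- The exponent of the term of `y^j` that belongs to an element of the Weyl group. -/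
lemma exists_exponent (hP : IsEuclidean P) (hm : m ≠ 0) (j : b.support) (σ : P.weylGroup) :
    ∃ y : ℕ × (b.support → ℤ),
      (σ • fundWeight b j = fundWeight b j → y = (0, Pi.single j 1)) ∧
      (σ • fundWeight b j ≠ fundWeight b j →
        y ∈ lowerExps (kappa b m) (theta b m) (weightHeight b) (0, Pi.single j 1)) ∧
      toWeight b m y = (theta b m j, σ • fundWeight b j) := by
  obtain ⟨hκ, -⟩ := kappa_spec b hP hm
  have hcone := sub_smul_mem_posCone hP (u := fundWeight b j)
    (fun i => ⟨if j = i then 1 else 0, by rw [inner_fundWeight_coroot]; push_cast; rfl⟩) σ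
  -- The `λ`-exponent is the `n` with `(ω_j - σ ω_j, ω) = n κ`: it restores the degree `θ_j`, and
  -- its being natural is what makes `y^j` polynomial in `λ`.
  obtain ⟨⟨n, hn⟩, hint, hpos⟩ := posCone_spec b hP hm hcone
  choose k hk using hint
  have hw : intWeight b (Pi.single j 1 - k) = σ • fundWeight b j := by
    refine eq_of_inner_coroot b fun i => ?_
    rw [inner_intWeight_coroot]
    have := hk i
    rw [inner_sub_left, inner_fundWeight_coroot] at this
    simp only [Pi.sub_apply, Pi.single_apply, Int.cast_sub, ← this, eq_comm (a := i)]
    push_cast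
    ring
  have hto : toWeight b m (n, Pi.single j 1 - k) = (theta b m j, σ • fundWeight b j) := by
    refine Prod.ext ?_ hw
    change kappa b m * (n : ℝ) + linWeight (fun i => ⟪fundWeight b i, weight b m⟫_ℝ)
      (Pi.single j 1 - k) = theta b m j
    rw [← inner_intWeight, hw]
    rw [inner_sub_left] at hn
    rw [theta]
    linarith
  have hsingle : toWeight b m (0, Pi.single j 1) = (theta b m j, fundWeight b j) := by
    refine Prod.ext ?_ (intWeight_single b j)
    simp [toWeight, expDegree, linWeight_single]
  refine ⟨(n, Pi.single j 1 - k), fun h => ?_, fun h => ⟨?_, ?_, Nat.zero_le _⟩, hto⟩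
  · refine toWeight_injective b m hκ.ne' ?_
    rw [hto, hsingle, h]
  · exact (congrArg Prod.fst hto).trans (congrArg Prod.fst hsingle).symm
  · change linWeight (fun i => ⟪fundWeight b i, weight b 1⟫_ℝ) _ <
      linWeight (fun i => ⟪fundWeight b i, weight b 1⟫_ℝ) _
    rw [← inner_intWeight, ← inner_intWeight, hw, intWeight_single]
    have := hpos (sub_ne_zero.mpr (Ne.symm h))
    rw [inner_sub_left] at this
    linarith

open Classical in
/-- The basic generators are represented by Laurent polynomials with leading exponents `ω_j`. -/
lemma exists_represents_basicGen (hP : IsEuclidean P) (hm : m ≠ 0) (j : b.support) :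
    ∃ Y, Represents (kappa b m) Y (basicGen b m j) ∧
      IsLeading (kappa b m) (theta b m) (weightHeight b) Y (0, Pi.single j 1) := by
  have := finite_weylGroup P
  have := Fintype.ofFinite P.weylGroup
  choose y hy1 hy2 hy3 using exists_exponent b hP hm j
  set c : ℂ := (Nat.card {σ : P.weylGroup // σ • fundWeight b j = fundWeight b j} : ℂ)⁻¹ with hc
  refine ⟨c • ∑ σ, AddMonoidAlgebra.single (y σ) 1, fun p => ?_, ?_⟩
  · change _ = evalPoint b m _ p
    have hterm : ∀ σ : P.weylGroup, evalPoint b m (AddMonoidAlgebra.single (y σ⁻¹) 1) p =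
        Complex.exp (-(2 * Real.pi * Complex.I * (theta b m j * p.2 : ℝ))) *
          Complex.exp (2 * Real.pi * Complex.I *
            (⟪fundWeight b j, σ • point b m p⟫_ℝ : ℝ)) := by
      intro σ
      rw [evalPoint_eq, AddMonoidAlgebra.coeff_single, Finsupp.mapDomain_single,
        Finsupp.linearCombination_single, one_smul, weightChar_ofAdd, hy3, hP.inner_smul_right,
        ← Complex.exp_add]
      congr 1
      push_cast
      ring
    have hsum : evalPoint b m (c • ∑ σ, AddMonoidAlgebra.single (y σ) 1) p =
        c * ∑ σ, evalPoint b m (AddMonoidAlgebra.single (y σ⁻¹) 1) p := by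
      -- Moving `σ` across the inner product turns it into `σ⁻¹`, hence the reindexing.
      rw [← Equiv.sum_comp (Equiv.inv P.weylGroup)]
      simp only [evalPoint, map_smul, map_sum, Pi.smul_apply, Finset.sum_apply, smul_eq_mul,
        Equiv.inv_apply]
    rw [hsum]
    simp only [hterm]
    rw [← Finset.mul_sum, basicGen, bigY, finsum_eq_sum_of_fintype]
    ring
  -- The stabilizer of `ω_j` accounts for the leading terms, and dividing by `N_j` makes their
  -- coefficient 1.
  · have hcard : c * ((Finset.univ.filter fun σ : P.weylGroup =>
        σ • fundWeight b j = fundWeight b j).card : ℂ) = 1 := by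
      rw [hc, Nat.card_eq_fintype_card, Fintype.card_subtype]
      refine inv_mul_cancel₀ (Nat.cast_ne_zero.mpr (Finset.card_ne_zero_of_mem (a := 1) ?_))
      simp
    have hdiff : c • ∑ σ, AddMonoidAlgebra.single (y σ) 1 -
        AddMonoidAlgebra.single ((0, Pi.single j 1) : ℕ × (b.support → ℤ)) 1 =
        c • ∑ σ ∈ Finset.univ.filter (fun σ : P.weylGroup =>
          ¬ σ • fundWeight b j = fundWeight b j), AddMonoidAlgebra.single (y σ) (1 : ℂ) := by
      rw [← Finset.sum_filter_add_sum_filter_not Finset.univ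
        (fun σ : P.weylGroup => σ • fundWeight b j = fundWeight b j), smul_add,
        Finset.sum_congr rfl (fun σ hσ => by rw [hy1 σ (Finset.mem_filter.mp hσ).2]),
        Finset.sum_const, ← Nat.cast_smul_eq_nsmul ℂ, smul_smul, hcard, one_smul,
        add_sub_cancel_left]
    rw [IsLeading, hdiff]
    exact Submodule.smul_mem _ _ (Submodule.sum_mem _ fun σ hσ =>
      single_mem_supportedIn (hy2 σ (Finset.mem_filter.mp hσ).2) _)

end BasicGenerators

end Invariants

/-! ### Proper generators -/

section Represented

variable {s : Type*} [Fintype s]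

lemma linearIndependent_character {κ : ℝ} (hκ : κ ≠ 0) : LinearIndependent ℂ
    (fun a : ℕ × (s → ℤ) => (character κ a : Multiplicative ((s → ℝ) × ℝ) → ℂ)) :=
  (linearIndependent_monoidHom (Multiplicative ((s → ℝ) × ℝ)) ℂ).comp _ (character_injective hκ)

/-- Under the translations `(x; c) ↦ (x + r θ; c - r)`, homogeneous functions are eigenfunctions
whose eigenvalue records the degree. -/
lemma mono_shift (θ : s → ℝ) (t₀ : ℝ) (t : s → ℝ) (r : ℝ) (p : (s → ℝ) × ℝ) :
    mono t₀ t (p.1 + r • θ, p.2 - r) =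
      Complex.exp (2 * Real.pi * Complex.I * ((-t₀ + ∑ j, t j * θ j) * r : ℝ)) * mono t₀ t p := by
  simp only [mono, ← Complex.exp_add, Pi.add_apply, Pi.smul_apply, smul_eq_mul, mul_add,
    Finset.sum_add_distrib]
  congr 1
  have : ∑ j, t j * (r * θ j) = (∑ j, t j * θ j) * r := by
    rw [Finset.sum_mul]
    exact Finset.sum_congr rfl fun j _ => by ring
  rw [this]
  push_cast
  ring

lemma IsHomogeneous.apply_shift {θ : s → ℝ} {d : ℝ} {f : (s → ℝ) × ℝ → ℂ}
    (hf : IsHomogeneous θ d f) (r : ℝ) (p : (s → ℝ) × ℝ) :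
    f (p.1 + r • θ, p.2 - r) = Complex.exp (2 * Real.pi * Complex.I * (d * r : ℝ)) * f p := by
  refine Submodule.span_induction (p := fun f _ => f (p.1 + r • θ, p.2 - r) =
    Complex.exp (2 * Real.pi * Complex.I * (d * r : ℝ)) * f p) ?_ ?_ ?_ ?_ hf
  · rintro _ ⟨t₀, t, rfl, rfl⟩
    exact mono_shift θ t₀ t r p
  · simp
  · intro f g _ _ hf hg
    rw [Pi.add_apply, hf, hg, Pi.add_apply, mul_add]
  · intro c f _ hf
    rw [Pi.smul_apply, hf, Pi.smul_apply, smul_eq_mul, smul_eq_mul, mul_left_comm]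

/-- A homogeneous function is represented by a Laurent polynomial with exponents of its degree. -/
lemma IsHomogeneous.mem_supportedIn {κ : ℝ} (hκ : κ ≠ 0) {θ : s → ℝ} {d : ℝ}
    {f : (s → ℝ) × ℝ → ℂ} (hf : IsHomogeneous θ d f) {Q : AddMonoidAlgebra ℂ (ℕ × (s → ℤ))}
    (hQ : Represents κ Q f) : Q ∈ supportedIn {x | expDegree κ θ x = d} := by
  intro y hy
  by_contra hne
  obtain ⟨r, hr⟩ := exists_exp_ne hne
  have hsum : ∀ p, f p = ∑ y ∈ Q.coeff.support, Q.coeff y * character κ y (.ofAdd p) := by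
    intro p
    rw [hQ p, laurentEval_eq, Finsupp.linearCombination_apply, Finsupp.sum, Finset.sum_apply]
    rfl
  have hchar : ∀ (y : ℕ × (s → ℤ)) p,
      character κ y (.ofAdd ((p.1 + r • θ, p.2 - r) : (s → ℝ) × ℝ)) =
        Complex.exp (2 * Real.pi * Complex.I * (expDegree κ θ y * r : ℝ)) *
          character κ y (.ofAdd p) := by
    intro y p
    have := mono_shift θ (-(κ * y.1)) (fun j => (y.2 j : ℝ)) r p
    rwa [neg_neg] at this
  have h0 := linearIndependent_iff'.mp (linearIndependent_character hκ) Q.coeff.support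
    (fun y => Q.coeff y * (Complex.exp (2 * Real.pi * Complex.I * (expDegree κ θ y * r : ℝ)) -
      Complex.exp (2 * Real.pi * Complex.I * (d * r : ℝ)))) (funext fun p => by
        have h1 := hf.apply_shift r p.toAdd
        rw [hsum, hsum, Finset.mul_sum, ← sub_eq_zero, ← Finset.sum_sub_distrib] at h1
        rw [Finset.sum_apply, Pi.zero_apply, ← h1]
        refine Finset.sum_congr rfl fun y _ => ?_
        rw [hchar, Pi.smul_apply, smul_eq_mul, ofAdd_toAdd]
        ring) y (Finsupp.mem_support_iff.mpr hy)
  exact hr (sub_eq_zero.mp ((mul_eq_zero.mp h0).resolve_left hy))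

/-- A Laurent polynomial which vanishes for `λ = 0` is divisible by `λ`. -/
lemma mem_supportedIn_of_laurentEval_zero {Q : AddMonoidAlgebra ℂ (ℕ × (s → ℤ))}
    (hQ : ∀ x, laurentEval Q (0, x) = 0) : Q ∈ supportedIn {x | 1 ≤ x.1} := by
  intro y hy
  by_contra hlt
  have hy0 : y.1 = 0 := by
    have : ¬ 1 ≤ y.1 := hlt
    omega
  -- The factor `0 ^ y.1` keeps exactly the terms free of `λ`. On those the character does not
  -- depend on `κ`, so the nonzero value 1 may be used.
  have h0 := linearIndependent_iff'.mp (linearIndependent_character (s := s) one_ne_zero)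
    Q.coeff.support (fun y => Q.coeff y * 0 ^ y.1) (funext fun p => ?_) y
    (Finsupp.mem_support_iff.mpr hy)
  · rw [hy0, pow_zero, mul_one] at h0
    exact hy h0
  · have h1 := hQ fun j => (p.toAdd.1 j : ℂ)
    rw [laurentEval, AddMonoidAlgebra.lift_apply, Finsupp.sum, Finset.sum_apply] at h1
    rw [Finset.sum_apply, Pi.zero_apply]
    refine (Finset.sum_congr rfl fun y _ => ?_).trans h1
    change Q.coeff y * 0 ^ y.1 * mono _ _ p.toAdd = Q.coeff y * (0 ^ y.1 * Complex.exp _)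
    rcases Nat.eq_zero_or_pos y.1 with h | h
    · rw [h, mul_assoc]
      congr 2
      simp only [mono]
      congr 1
      simp
    · rw [zero_pow h.ne']
      ring

end Represented

section ProperGenerators

variable {ι V N : Type*} [NormedAddCommGroup V] [InnerProductSpace ℝ V] [FiniteDimensional ℝ V]
  [AddCommGroup N] [Module ℝ N] {P : RootPairing ι ℝ V N} [P.IsRootSystem] (b : P.Base)
  (m : b.support → ℕ)

/-- Evaluation of Laurent polynomials as functions of `(x; c)`, as a homomorphism. -/
def evalPointHom :
    AddMonoidAlgebra ℂ (ℕ × (b.support → ℤ)) →ₐ[ℂ] ((b.support → ℝ) × ℝ → ℂ) where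
  toFun := evalPoint b m
  map_one' := funext fun p => by simp [evalPoint]
  map_mul' Q Q' := funext fun p => by simp [evalPoint]
  map_zero' := funext fun p => by simp [evalPoint]
  map_add' Q Q' := funext fun p => by simp [evalPoint]
  commutes' r := funext fun _ => congrFun (laurentEval.commutes r) _

variable {m} in
lemma evalPointHom_eq {Q : AddMonoidAlgebra ℂ (ℕ × (b.support → ℤ))}
    {f : (b.support → ℝ) × ℝ → ℂ} (h : Represents (kappa b m) Q f) : evalPointHom b m Q = f :=
  funext fun p => (h p).symm

lemma evalPointHom_lamVar : evalPointHom b m lamVar = lam (kappa b m) :=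
  funext fun _ => laurentEval_lamVar _

lemma lam_mem_invariantRing : lam (kappa b m) ∈ invariantRing b m := by
  refine ⟨Algebra.subset_adjoin (Or.inl (Or.inl rfl)), ?_⟩
  have h : IsInvariant b m (evalPointHom b m lamVar) := lamVar_mem_invariantLaurent b m
  rwa [evalPointHom_lamVar] at h

variable {m} in
lemma mem_invariantLaurent {Q : AddMonoidAlgebra ℂ (ℕ × (b.support → ℤ))}
    {f : (b.support → ℝ) × ℝ → ℂ} (h : Represents (kappa b m) Q f) (hf : IsInvariant b m f) :
    Q ∈ invariantLaurent b m := by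
  rw [← evalPointHom_eq b h] at hf
  exact hf

variable {m} [Finite ι] [P.IsCrystallographic] [P.IsReduced] [P.IsIrreducible]

/-- A Weyl element only reindexes the sum. A coroot translation adds an integer to each exponent,
since the weights `τ⁻¹ ω_j` pair integrally with the simple coroots; the prefactor depends only on
`c`. -/
lemma isInvariant_basicGen (hP : IsEuclidean P) (hm : m ≠ 0) (j : b.support) :
    IsInvariant b m (basicGen b m j) := by
  intro σ k x x' c h
  rw [basicGen, basicGen, bigY, bigY, h]
  congr 2
  have := finite_weylGroup P
  have := Fintype.ofFinite P.weylGroup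
  rw [finsum_eq_sum_of_fintype, finsum_eq_sum_of_fintype,
    ← Equiv.sum_comp (Equiv.mulRight σ) fun τ : P.weylGroup => Complex.exp
      (2 * Real.pi * Complex.I * (⟪fundWeight b j, τ • point b m (x, c)⟫_ℝ : ℝ))]
  refine Finset.sum_congr rfl fun τ _ => ?_
  obtain ⟨y, -, -, hy⟩ := exists_exponent b hP hm j τ⁻¹
  have hw : intWeight b y.2 = τ⁻¹ • fundWeight b j := congrArg Prod.snd hy
  have hint : ⟪fundWeight b j, τ • ∑ i : b.support, (k i : ℝ) • coroot P i⟫_ℝ =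
      ((∑ i, k i * y.2 i : ℤ) : ℝ) := by
    rw [hP.inner_smul_right, ← hw, inner_sum]
    push_cast
    exact Finset.sum_congr rfl fun i _ => by
      rw [real_inner_smul_right, inner_intWeight_coroot]
  rw [Equiv.coe_mulRight, mul_smul, smul_add, inner_add_right, hint]
  refine Complex.exp_eq_exp_iff_exists_int.mpr ⟨∑ i, k i * y.2 i, ?_⟩
  push_cast
  ring

open Classical in
/-- Proper generators differ from basic generators by polynomials in `λ` and the basic generators
of smaller degree. -/
lemma IsProperGenerators.exists_laurent (hP : IsEuclidean P) (hm : m ≠ 0)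
    {z : b.support → (b.support → ℝ) × ℝ → ℂ} (hz : IsProperGenerators b m z) :
    ∃ Y Z : b.support → AddMonoidAlgebra ℂ (ℕ × (b.support → ℤ)),
      (∀ j, Represents (kappa b m) (Y j) (basicGen b m j)) ∧
      (∀ j, Represents (kappa b m) (Z j) (z j)) ∧
      (∀ j, IsLeading (kappa b m) (theta b m) (weightHeight b) (Y j) (0, Pi.single j 1)) ∧
      (∀ Q ∈ invariantLaurent b m, Q ∈ Algebra.adjoin ℂ (insert lamVar (Set.range Y))) ∧
      ∀ j, Z j - Y j ∈
        Algebra.adjoin ℂ (insert lamVar (Y '' {i | theta b m i < theta b m j})) := by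
  obtain ⟨hκ, -⟩ := kappa_spec b hP hm
  choose Y hY hlead using exists_represents_basicGen b hP hm
  choose Z hZ using fun j => exists_represents (hz.mem j).1
  have hYinv : ∀ j, Y j ∈ invariantLaurent b m := fun j =>
    mem_invariantLaurent b (hY j) (isInvariant_basicGen b hP hm j)
  have hZinv : ∀ j, Z j ∈ invariantLaurent b m := fun j =>
    mem_invariantLaurent b (hZ j) (hz.mem j).2
  have key := fun {Q} (hQ : Q ∈ invariantLaurent b m) =>
    mem_adjoin_of_isLeading hκ (theta_nonneg b hP m) (weightHeight_pos b hP)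
      (fun Q hQ x hx i hi => exists_higher_exponent b m hP hκ.ne' hQ hx hi)
      (lamVar_mem_invariantLaurent b m) hYinv hlead hQ
  refine ⟨Y, Z, hY, hZ, hlead, fun Q hQ => (key hQ).1, fun j =>
    (key (sub_mem (hZinv j) (hYinv j))).2 _ ?_⟩
  have hYdeg : Y j ∈ supportedIn {x | expDegree (kappa b m) (theta b m) x = theta b m j} := by
    have he : expDegree (kappa b m) (theta b m) (0, Pi.single j 1) = theta b m j := by
      rw [expDegree, linWeight_single]
      simp
    have h1 := add_mem (supportedIn_mono (fun x hx => hx.1.trans he) (hlead j))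
      (single_mem_supportedIn he 1)
    rwa [sub_add_cancel] at h1
  have hdeg := sub_mem ((hz.homogeneous j).mem_supportedIn hκ.ne' (hZ j)) hYdeg
  -- Agreement of `z^j` and `y^j` at `λ = 0` is used only here.
  have hdiv : Z j - Y j ∈ supportedIn {x | 1 ≤ x.1} := by
    refine mem_supportedIn_of_laurentEval_zero fun x => ?_
    have h1 := congrFun (hz.null_eq j) x
    rw [specialize_eq hκ.ne' (hZ j), specialize_eq hκ.ne' (hY j)] at h1
    rw [map_sub, Pi.sub_apply, h1, sub_self]
  exact fun x hx => ⟨hdiv x hx, hdeg x hx⟩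

end ProperGenerators

end AffineWeyl

end

theorem mainTheorem8 {ι V N : Type*} [Finite ι]
    [NormedAddCommGroup V] [InnerProductSpace ℝ V] [FiniteDimensional ℝ V]
    [AddCommGroup N] [Module ℝ N]
    (P : RootPairing ι ℝ V N) [P.IsRootSystem] [P.IsCrystallographic] [P.IsReduced]
    [P.IsIrreducible] (hP : AffineWeyl.IsEuclidean P) (b : P.Base)
    (m : b.support → ℕ) (hm : m ≠ 0)
    (z : b.support → (b.support → ℝ) × ℝ → ℂ) (hz : AffineWeyl.IsProperGenerators b m z) :
    AffineWeyl.invariantRing b m =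
        Algebra.adjoin ℂ (insert (AffineWeyl.lam (AffineWeyl.kappa b m)) (Set.range z)) ∧
      (∀ (μ : ℂ) (x : b.support → ℂ),
        AffineWeyl.jacobian
            (fun j => AffineWeyl.specialize (AffineWeyl.kappa b m) (z j) μ) x =
          AffineWeyl.jacobian
            (fun j => AffineWeyl.specialize (AffineWeyl.kappa b m)
              (AffineWeyl.basicGen b m j) μ) x) ∧
      ∀ μ : ℂ, AffineWeyl.FunctionallyIndependent
        (fun j => AffineWeyl.specialize (AffineWeyl.kappa b m) (z j) μ) := by
  classical
  obtain ⟨hκ, -⟩ := AffineWeyl.kappa_spec b hP hm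
  obtain ⟨Y, Z, hY, hZ, hlead, hgen, hdiff⟩ := hz.exists_laurent b hP hm
  have hspecY : ∀ μ, (fun j => AffineWeyl.specialize (AffineWeyl.kappa b m)
      (AffineWeyl.basicGen b m j) μ) = fun j x => AffineWeyl.laurentEval (Y j) (μ, x) :=
    fun μ => funext fun j => funext fun x => AffineWeyl.specialize_eq hκ.ne' (hY j) μ x
  have hspecZ : ∀ μ, (fun j => AffineWeyl.specialize (AffineWeyl.kappa b m) (z j) μ) =
      fun j x => AffineWeyl.laurentEval (Z j) (μ, x) :=
    fun μ => funext fun j => funext fun x => AffineWeyl.specialize_eq hκ.ne' (hZ j) μ x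
  have hjac : ∀ μ x, AffineWeyl.jacobian (fun j x => AffineWeyl.laurentEval (Z j) (μ, x)) x =
      AffineWeyl.jacobian (fun j x => AffineWeyl.laurentEval (Y j) (μ, x)) x := by
    intro μ x
    refine AffineWeyl.jacobian_eq_of_sub_mem_span (AffineWeyl.theta b m) fun j => ?_
    have h1 := AffineWeyl.laurentDeriv_mem_span μ x (hdiff j)
    rw [Set.image_image] at h1
    have h2 := AffineWeyl.laurentDeriv_add μ x (Z j - Y j) (Y j)
    rw [sub_add_cancel, ← sub_eq_iff_eq_add] at h2
    rw [← h2] at h1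
    exact h1
  refine ⟨le_antisymm (fun f hf => ?_) (Algebra.adjoin_le ?_), fun μ x => ?_, fun μ => ?_⟩
  · obtain ⟨Q, hQ⟩ := AffineWeyl.exists_represents hf.1
    have hQY := hgen Q (AffineWeyl.mem_invariantLaurent b hQ hf.2)
    have hQZ : Q ∈ Algebra.adjoin ℂ (insert AffineWeyl.lamVar (Set.range Z)) := by
      refine Algebra.adjoin_le ?_ hQY
      rintro _ (rfl | ⟨j, rfl⟩)
      · exact Algebra.subset_adjoin (Set.mem_insert _ _)
      · exact AffineWeyl.mem_adjoin_of_sub_mem_adjoin hdiff j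
    -- The identity of Laurent polynomials is carried to functions of `(x; c)` by evaluation.
    have himage := Subalgebra.mem_map.mpr ⟨Q, hQZ, AffineWeyl.evalPointHom_eq b hQ⟩
    rw [AlgHom.map_adjoin, Set.image_insert_eq, AffineWeyl.evalPointHom_lamVar,
      ← Set.range_comp] at himage
    have hcomp : AffineWeyl.evalPointHom b m ∘ Z = z :=
      funext fun j => AffineWeyl.evalPointHom_eq b (hZ j)
    rwa [hcomp] at himage
  · rintro _ (rfl | ⟨j, rfl⟩)
    · exact AffineWeyl.lam_mem_invariantRing b m
    · exact hz.mem j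
  · rw [hspecY, hspecZ]
    exact hjac μ x
  · rw [hspecZ]
    refine AffineWeyl.functionallyIndependent_of_jacobian
      (fun j x => AffineWeyl.analyticAt_laurentEval (Z j) μ x) ?_
    obtain ⟨x, hx⟩ := AffineWeyl.exists_jacobian_ne_zero hlead μ
    exact ⟨x, by rwa [hjac]⟩
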